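/- Let $k\ge 0$ and $n\ge 2k+3$ be integers. Let $(\Sigma^{k+1},g_\Sigma)$ be a compact hyperbolic manifold, that is, a compact smooth Riemannian manifold which is a quotient of hyperbolic space $H^{k+1}$ (equivalently, there is a Riemannian covering $p\colon H^{k+1}\to\Sigma$; for $k=0$, where $H^1\cong\mathbb{R}$, these are the circles). Let $$(M,g):=\bigl(S^{n-k-1}\times\Sigma^{k+1},\; g_{S^{n-k-1}}\oplus g_\Sigma\bigr)$$ be the Riemannian product with the unit round sphere. Then: 1. The scalar curvature of $g$ is constant and positive: $R_g\equiv (n-2k-2)(n-1)>0$. 2. The Yamabe constant of the conformal class of $g$ is positive: $$Y(M,[g])=\inf_{0<u\in C^\infty(M)}\frac{\int_M\bigl(\tfrac{4(n-1)}{n-2}|\nabla u|_g^2+R_g u^2\bigr)\,dv_g}{\bigl(\int_M u^{\frac{2n}{n-2}}\,dv_g\bigr)^{\frac{n-2}{n}}}>0 .$$ 3. For every Riemannian covering $p\colon H^{k+1}\to\Sigma$, the map $\mathrm{id}\times p\colon S^{n-k-1}\times H^{k+1}\to M$ is a universal covering and is a Riemannian covering for the product metrics. Every universal covering $\pi\colon\widetilde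 M\to M$ has total space $\widetilde M$ diffeomorphic to $S^{n-k-1}\times\mathbb{R}^{k+1}$; moreover $\widetilde M$ is not contractible, and $(\widetilde M,\pi^*g)$ is not conformally equivalent to Euclidean space $(\mathbb{R}^n,\delta)$, that is, there are no diffeomorphism $\Phi\colon\widetilde M\to\mathbb{R}^n$ and function $u\in C^\infty(\widetilde M)$ with $\Phi^*\delta=e^{2u}\pi^*g$. -/

import Mathlib

open scoped Manifold ContDiff
open Module MeasureTheory

noncomputable section

/-! ### Symmetric two-tensors on manifolds -/

section Tensors

variable {E : Type*} [NormedAddCommGroup E] [NormedSpace ℝ E]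
  {H : Type*} [TopologicalSpace H] {I : ModelWithCorners ℝ E H}
  {M : Type*} [TopologicalSpace M] [ChartedSpace H M]
  {F : Type*} [NormedAddCommGroup F] [NormedSpace ℝ F]
  {G : Type*} [TopologicalSpace G] {J : ModelWithCorners ℝ F G}
  {N : Type*} [TopologicalSpace N] [ChartedSpace G N]

/-- A field of bilinear forms on the tangent spaces of a manifold. -/
abbrev TwoTensor {E : Type*} [NormedAddCommGroup E] [NormedSpace ℝ E]
    {H : Type*} [TopologicalSpace H] (I : ModelWithCorners ℝ E H)
    (M : Type*) [TopologicalSpace M] [ChartedSpace H M] : Type _ :=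
  ∀ x : M, LinearMap.BilinForm ℝ (TangentSpace I x)

/-- The pullback `f^* g`. -/
def TwoTensor.pullback (I : ModelWithCorners ℝ E H) (g : TwoTensor J N) (f : M → N) :
    TwoTensor I M :=
  fun x => (g (f x)).compl₁₂ (mfderiv I J f x).toLinearMap (mfderiv I J f x).toLinearMap

/-- The product tensor `g ⊕ h = pr₁^* g + pr₂^* h`. -/
def TwoTensor.prod (g : TwoTensor I M) (h : TwoTensor J N) : TwoTensor (I.prod J) (M × N) :=
  fun p => TwoTensor.pullback (I.prod J) g Prod.fst p + TwoTensor.pullback (I.prod J) h Prod.snd p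

/-- The two-tensor underlying a smooth Riemannian metric. -/
def riemannianTensor [IsManifold I ∞ M]
    (g : Bundle.ContMDiffRiemannianMetric I ∞ E (TangentSpace I : M → Type _)) : TwoTensor I M :=
  fun x => LinearMap.mk₂ ℝ (fun v w => g.inner x v w) (by simp) (by simp) (by simp) (by simp)

/-- `(M, g)` and `(N, h)` are conformally equivalent: there is a diffeomorphism `Φ : M → N` with
`Φ^* h = e^{2u} g` for a smooth function `u`. -/
def ConformallyEquivalent (g : TwoTensor I M) (h : TwoTensor J N) : Prop :=
  ∃ (Φ : M ≃ₘ^∞⟮I, J⟯ N) (u : M → ℝ), ContMDiff I 𝓘(ℝ, ℝ) ∞ u ∧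
    TwoTensor.pullback I h Φ = fun x => Real.exp (2 * u x) • g x

/-- A smooth covering map. -/
def IsSmoothCovering (I : ModelWithCorners ℝ E H) (J : ModelWithCorners ℝ F G)
    (p : M → N) : Prop :=
  IsCoveringMap p ∧ Function.Surjective p ∧ IsLocalDiffeomorph I J ∞ p

/-- A Riemannian covering `(M, g) → (N, h)`. -/
def IsRiemannianCovering (g : TwoTensor I M) (h : TwoTensor J N) (p : M → N) : Prop :=
  IsSmoothCovering I J p ∧ TwoTensor.pullback I h p = g

/-- A universal covering in the smooth category. -/
def IsUniversalCovering (I : ModelWithCorners ℝ E H) (J : ModelWithCorners ℝ F G)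
    (p : M → N) : Prop :=
  SimplyConnectedSpace M ∧ IsSmoothCovering I J p

end Tensors

/-! ### Curvature in coordinates -/

section LocalCurvature

variable {E : Type*} [NormedAddCommGroup E] [NormedSpace ℝ E]
  {ι : Type*} [Fintype ι] [DecidableEq ι]

/-- The matrix of a bilinear form with respect to a basis. -/
def gram (b : Basis ι ℝ E) (B : LinearMap.BilinForm ℝ E) : Matrix ι ι ℝ :=
  Matrix.of fun i j => B (b i) (b j)

/-- The Christoffel symbols of `g` on the vector space `E`, as an `E`-valued bilinear expression:
`Γ(v,w) = ∑ g^{lm} ½ (∂_v g(w,b_m) + ∂_w g(v,b_m) - ∂_{b_m} g(v,w)) b_l`. -/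
def christoffel (b : Basis ι ℝ E) (g : E → LinearMap.BilinForm ℝ E) (y v w : E) : E :=
  ∑ l, ∑ m, ((gram b (g y))⁻¹ l m * (1 / 2 : ℝ) *
    (fderiv ℝ (fun z => g z w (b m)) y v + fderiv ℝ (fun z => g z v (b m)) y w
      - fderiv ℝ (fun z => g z v w) y (b m))) • b l

/-- The curvature `R(u,v)w = ∇_u ∇_v w - ∇_v ∇_u w` for constant vector fields `u, v, w` on `E`. -/
def localCurvature (b : Basis ι ℝ E) (g : E → LinearMap.BilinForm ℝ E) (y u v w : E) : E :=
  fderiv ℝ (fun z => christoffel b g z v w) y u - fderiv ℝ (fun z => christoffel b g z u w) y v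
    + christoffel b g y u (christoffel b g y v w) - christoffel b g y v (christoffel b g y u w)

/-- The Ricci curvature: the trace of `u ↦ R(u,v)w`. -/
def localRicci (b : Basis ι ℝ E) (g : E → LinearMap.BilinForm ℝ E) (y v w : E) : ℝ :=
  ∑ i, b.coord i (localCurvature b g y (b i) v w)

/-- The scalar curvature: the `g`-trace of the Ricci curvature. -/
def localScalarCurvature (b : Basis ι ℝ E) (g : E → LinearMap.BilinForm ℝ E) (y : E) : ℝ :=
  ∑ i, ∑ j, (gram b (g y))⁻¹ i j * localRicci b g y (b i) (b j)

end LocalCurvature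

/-! ### Scalar curvature, volume and Yamabe constant of a manifold without boundary -/

section Yamabe

variable {E : Type*} [NormedAddCommGroup E] [NormedSpace ℝ E] [FiniteDimensional ℝ E]
  {H : Type*} [TopologicalSpace H] {I : ModelWithCorners ℝ E H}
  {M : Type*} [TopologicalSpace M] [ChartedSpace H M]

/-- The coefficients of `g` in the preferred chart at `x`, as a field of bilinear forms on `E`. -/
def chartCoefficients (g : TwoTensor I M) (x : M) : E → LinearMap.BilinForm ℝ E :=
  fun y => TwoTensor.pullback 𝓘(ℝ, E) g (extChartAt I x).symm y

/-- The scalar curvature `R_g`. -/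
def scalarCurvature (g : TwoTensor I M) (x : M) : ℝ :=
  localScalarCurvature (finBasis ℝ E) (chartCoefficients g x) (extChartAt I x x)

/-- `|∇u|_g^2 = g^{ij} ∂_i u ∂_j u`, computed in a basis of the tangent space at `x`. -/
def gradNormSq (g : TwoTensor I M) (u : M → ℝ) (x : M) : ℝ :=
  ∑ i, ∑ j, (gram (E := E) (finBasis ℝ E) (g x))⁻¹ i j *
    (show E →L[ℝ] ℝ from mfderiv I 𝓘(ℝ, ℝ) u x) (finBasis ℝ E i) *
    (show E →L[ℝ] ℝ from mfderiv I 𝓘(ℝ, ℝ) u x) (finBasis ℝ E j)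

variable [MeasurableSpace E] [BorelSpace E] [MeasurableSpace M] [BorelSpace M]

/-- The measure `√(det g_ij) dy` on the domain of the preferred chart at `x`, extended by zero. -/
def chartVolume (g : TwoTensor I M) (x : M) : Measure M :=
  Measure.map (extChartAt I x).symm
    (((finBasis ℝ E).addHaar.restrict (extChartAt I x).target).withDensity fun y =>
      ENNReal.ofReal √(gram (finBasis ℝ E) (chartCoefficients g x y)).det)

/-- The Riemannian volume measure `dv_g`. The measures `chartVolume g x` agree on the overlaps of
the chart domains, so their supremum is the measure that restricts to each of them. -/
def riemannianVolume (g : TwoTensor I M) : Measure M :=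
  ⨆ x : M, chartVolume g x

/-- The Yamabe quotient
`(∫ a_n |∇u|² + R_g u²) / (∫ u^{2n/(n-2)})^{(n-2)/n}` with `n = dim M`, `a_n = 4(n-1)/(n-2)`. -/
def yamabeQuotient (g : TwoTensor I M) (u : M → ℝ) : ℝ :=
  let n : ℝ := finrank ℝ E
  (∫ x, (4 * (n - 1) / (n - 2) * gradNormSq g u x + scalarCurvature g x * u x ^ 2)
      ∂riemannianVolume g) /
    (∫ x, u x ^ (2 * n / (n - 2)) ∂riemannianVolume g) ^ ((n - 2) / n)

/-- The Yamabe constant: the infimum of the Yamabe quotient over positive smooth functions. -/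
def yamabeConstant (g : TwoTensor I M) : ℝ :=
  ⨅ u : {u : M → ℝ // ContMDiff I 𝓘(ℝ, ℝ) ∞ u ∧ ∀ x, 0 < u x}, yamabeQuotient g u.1

end Yamabe

/-! ### The model spaces -/

/-- The flat metric of `ℝ^d`. -/
def flatMetric (d : ℕ) : TwoTensor (𝓡 d) (EuclideanSpace ℝ (Fin d)) :=
  fun _ => innerₗ (EuclideanSpace ℝ (Fin d))

/-- The unit sphere `S^d` in `ℝ^{d+1}`. -/
abbrev UnitSphere (d : ℕ) : Type :=
  Metric.sphere (0 : EuclideanSpace ℝ (Fin (d + 1))) 1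

/-- The round metric of `S^d`. -/
def roundMetric (d : ℕ) : TwoTensor (𝓡 d) (UnitSphere d) :=
  TwoTensor.pullback (𝓡 d) (flatMetric (d + 1)) Subtype.val

/-- The open upper half-space of `ℝ^{k+1}`. -/
def upperHalfSpace (k : ℕ) : TopologicalSpace.Opens (EuclideanSpace ℝ (Fin (k + 1))) :=
  ⟨{y | 0 < y 0}, isOpen_lt continuous_const (by fun_prop)⟩

/-- The hyperbolic metric `|dy|² / y_0²` of `H^{k+1}`, in the upper half-space model. -/
def hyperbolicMetric (k : ℕ) : TwoTensor (𝓡 (k + 1)) (upperHalfSpace k) :=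
  fun y => (1 / (y.1 0) ^ 2 : ℝ) •
    TwoTensor.pullback (𝓡 (k + 1)) (flatMetric (k + 1)) Subtype.val y

/-- `(S, g)` is a compact hyperbolic manifold of dimension `k + 1`, that is, a compact quotient of
`H^{k+1}`: it is compact and `H^{k+1}` covers it by a Riemannian covering map. For `k = 0` these
are the circles. -/
def IsCompactHyperbolic {k : ℕ} {S : Type*} [TopologicalSpace S]
    [ChartedSpace (EuclideanSpace ℝ (Fin (k + 1))) S]
    (g : TwoTensor (𝓡 (k + 1)) S) : Prop :=
  CompactSpace S ∧ ∃ p : upperHalfSpace k → S, IsRiemannianCovering (hyperbolicMetric k) g p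

end

noncomputable section

/-! ### The Levi-Civita connection in coordinates -/

section LeviCivita

open scoped Topology

variable {E : Type*} [NormedAddCommGroup E] [NormedSpace ℝ E]
  {ι : Type*} [Fintype ι] [DecidableEq ι]

theorem sum_gram_inv_mul (b : Basis ι ℝ E) (B : LinearMap.BilinForm ℝ E)
    (hsymm : ∀ v w, B v w = B w v) (hdet : IsUnit (gram b B).det) (X : E) (l : ι) :
    ∑ m, (gram b B)⁻¹ l m * B X (b m) = b.repr X l := by
  have h1 : ∀ m, B X (b m) = (gram b B).mulVec (b.repr X) m := by
    intro m
    conv_lhs => rw [← b.sum_repr X]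
    simp only [map_sum, map_smul, LinearMap.sum_apply, LinearMap.smul_apply, smul_eq_mul,
      Matrix.mulVec, dotProduct, gram, Matrix.of_apply]
    exact Finset.sum_congr rfl fun i _ => by rw [hsymm, mul_comm]
  have h2 : (gram b B)⁻¹.mulVec ((gram b B).mulVec (b.repr X)) l = b.repr X l := by
    rw [Matrix.mulVec_mulVec, Matrix.nonsing_inv_mul _ hdet, Matrix.one_mulVec]
  rw [← h2]
  simp only [h1]
  rfl

theorem isUnit_det_gram (b : Basis ι ℝ E) (B : LinearMap.BilinForm ℝ E)
    (h : ∀ v, (∀ w, B v w = 0) → v = 0) : IsUnit (gram b B).det := by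
  rw [isUnit_iff_ne_zero]
  intro h0
  obtain ⟨x, hx, hx0⟩ := Matrix.exists_vecMul_eq_zero_iff.2 h0
  refine hx ?_
  have h1 : ∑ i, x i • b i = 0 := by
    refine h _ fun w => ?_
    rw [← b.sum_repr w, map_sum]
    refine Finset.sum_eq_zero fun m _ => ?_
    have := congrFun hx0 m
    simp only [Matrix.vecMul, dotProduct, gram, Matrix.of_apply, Pi.zero_apply] at this
    simp [this]
  funext i
  exact Fintype.linearIndependent_iff.1 b.linearIndependent x h1 i

theorem christoffel_eq_of_koszul (b : Basis ι ℝ E) (g : E → LinearMap.BilinForm ℝ E) (y v w X : E)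
    (hsymm : ∀ v w, g y v w = g y w v) (hdet : IsUnit (gram b (g y)).det)
    (h : ∀ z, 2 * g y X z = fderiv ℝ (fun x => g x w z) y v + fderiv ℝ (fun x => g x v z) y w
      - fderiv ℝ (fun x => g x v w) y z) :
    christoffel b g y v w = X := by
  conv_rhs => rw [← b.sum_repr X]
  unfold christoffel
  refine Finset.sum_congr rfl fun l _ => ?_
  rw [← Finset.sum_smul, ← sum_gram_inv_mul b (g y) hsymm hdet X l]
  congr 1
  refine Finset.sum_congr rfl fun m _ => ?_
  rw [← h (b m)]
  ring

/-- `Γ` is the Levi-Civita connection of the metric `h` at `x`. -/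
structure IsLeviCivitaAt (h : E → E →L[ℝ] E →L[ℝ] ℝ) (Γ : E → E →L[ℝ] E →L[ℝ] E) (x : E) :
    Prop where
  symm : ∀ v w, h x v w = h x w v
  nondegenerate : ∀ v, (∀ w, h x v w = 0) → v = 0
  differentiableAt : DifferentiableAt ℝ h x
  koszul : ∀ v w z, 2 * h x (Γ x v w) z =
    fderiv ℝ h x v w z + fderiv ℝ h x w v z - fderiv ℝ h x z v w

/-- The curvature `R(u,v)w` of the connection `Γ`. -/
def connectionCurvature (Γ : E → E →L[ℝ] E →L[ℝ] E) (x u v w : E) : E :=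
  fderiv ℝ Γ x u v w - fderiv ℝ Γ x v u w + Γ x u (Γ x v w) - Γ x v (Γ x u w)

/-- The pullback of the metric `h` by a map `φ` of vector spaces. -/
def pullbackForm (h : E → E →L[ℝ] E →L[ℝ] ℝ) (φ : E → E) (z : E) : LinearMap.BilinForm ℝ E :=
  LinearMap.mk₂ ℝ (fun v w => h (φ z) (fderiv ℝ φ z v) (fderiv ℝ φ z w))
    (by simp) (by simp) (by simp) (by simp)

@[simp] theorem pullbackForm_apply (h : E → E →L[ℝ] E →L[ℝ] ℝ) (φ : E → E) (z v w : E) :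
    pullbackForm h φ z v w = h (φ z) (fderiv ℝ φ z v) (fderiv ℝ φ z w) := rfl

theorem fderiv_pullbackForm {h : E → E →L[ℝ] E →L[ℝ] ℝ} {φ : E → E} {z : E}
    (hφ : ContDiffAt ℝ 2 φ z) (hh : DifferentiableAt ℝ h (φ z)) (u v w : E) :
    fderiv ℝ (fun x => pullbackForm h φ x v w) z u =
      fderiv ℝ h (φ z) (fderiv ℝ φ z u) (fderiv ℝ φ z v) (fderiv ℝ φ z w)
        + h (φ z) (fderiv ℝ (fderiv ℝ φ) z u v) (fderiv ℝ φ z w)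
        + h (φ z) (fderiv ℝ φ z v) (fderiv ℝ (fderiv ℝ φ) z u w) := by
  have h1 : HasFDerivAt φ (fderiv ℝ φ z) z := (hφ.differentiableAt (by norm_num)).hasFDerivAt
  have h2 : HasFDerivAt (fderiv ℝ φ) (fderiv ℝ (fderiv ℝ φ) z) z :=
    ((hφ.fderiv_right (m := 1) (by norm_num)).differentiableAt (by norm_num)).hasFDerivAt
  have h3 : HasFDerivAt (fun x => h (φ x)) ((fderiv ℝ h (φ z)).comp (fderiv ℝ φ z)) z :=
    HasFDerivAt.comp (g := h) z hh.hasFDerivAt h1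
  have h4 : ∀ v, HasFDerivAt (fun x => fderiv ℝ φ x v) ((fderiv ℝ (fderiv ℝ φ) z).flip v) z := by
    intro v
    simpa using h2.clm_apply (hasFDerivAt_const v z)
  have h5 := (h3.clm_apply (h4 v)).clm_apply (h4 w)
  have h6 : fderiv ℝ (fun x => pullbackForm h φ x v w) z = _ := h5.fderiv
  rw [h6]
  simp
  ring

/-- The transformation law of Christoffel symbols. -/
theorem christoffel_pullback {b : Basis ι ℝ E} {g : E → LinearMap.BilinForm ℝ E}
    {h : E → E →L[ℝ] E →L[ℝ] ℝ} {Γ : E → E →L[ℝ] E →L[ℝ] E} {φ : E → E} {z : E}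
    (hφ : ContDiffAt ℝ 2 φ z) (hA : (fderiv ℝ φ z).IsInvertible)
    (hΓ : IsLeviCivitaAt h Γ (φ z)) (hg : g =ᶠ[𝓝 z] pullbackForm h φ) (v w : E) :
    christoffel b g z v w = (fderiv ℝ φ z).inverse
      (Γ (φ z) (fderiv ℝ φ z v) (fderiv ℝ φ z w) + fderiv ℝ (fderiv ℝ φ) z v w) := by
  have hgz : g z = pullbackForm h φ z := hg.self_of_nhds
  have hsymm2 : IsSymmSndFDerivAt ℝ φ z := hφ.isSymmSndFDerivAt (by simp)
  have hA' : ∀ X, fderiv ℝ φ z ((fderiv ℝ φ z).inverse X) = X := by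
    obtain ⟨e, he⟩ := hA
    intro X
    rw [← he]
    simp
  have hgd : ∀ u v w, fderiv ℝ (fun x => g x v w) z u =
      fderiv ℝ (fun x => pullbackForm h φ x v w) z u := by
    intro u v w
    rw [Filter.EventuallyEq.fderiv_eq]
    filter_upwards [hg] with x hx
    rw [hx]
  apply christoffel_eq_of_koszul
  · intro v w
    rw [hgz]
    exact hΓ.symm _ _
  · apply isUnit_det_gram
    intro v hv
    obtain ⟨e, he⟩ := hA
    have : fderiv ℝ φ z v = 0 := by
      apply hΓ.nondegenerate
      intro w
      have := hv ((fderiv ℝ φ z).inverse w)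
      rw [hgz, pullbackForm_apply, hA'] at this
      exact this
    rw [← he] at this
    simpa using this
  · intro x
    simp only [hgd, fderiv_pullbackForm hφ hΓ.differentiableAt]
    rw [hgz, pullbackForm_apply, hA']
    have hk := hΓ.koszul (fderiv ℝ φ z v) (fderiv ℝ φ z w) (fderiv ℝ φ z x)
    rw [map_add, add_apply, mul_add, hk]
    rw [hΓ.symm (fderiv ℝ φ z w) (fderiv ℝ (fderiv ℝ φ) z v x),
      hΓ.symm (fderiv ℝ φ z v) (fderiv ℝ (fderiv ℝ φ) z w x),
      hΓ.symm (fderiv ℝ φ z v) (fderiv ℝ (fderiv ℝ φ) z x w),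
      hsymm2.eq x v, hsymm2.eq x w, hsymm2.eq w v]
    ring

/-- Curvature is natural under local diffeomorphisms. -/
theorem localCurvature_pullback [CompleteSpace E] {b : Basis ι ℝ E}
    {g : E → LinearMap.BilinForm ℝ E}
    {h : E → E →L[ℝ] E →L[ℝ] ℝ} {Γ : E → E →L[ℝ] E →L[ℝ] E} {φ : E → E} {y : E}
    (hφ : ContDiffAt ℝ ∞ φ y) (hA : (fderiv ℝ φ y).IsInvertible)
    (hΓ : ∀ᶠ x in 𝓝 (φ y), IsLeviCivitaAt h Γ x) (hΓd : DifferentiableAt ℝ Γ (φ y))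
    (hg : g =ᶠ[𝓝 y] pullbackForm h φ) (u v w : E) :
    fderiv ℝ φ y (localCurvature b g y u v w) =
      connectionCurvature Γ (φ y) (fderiv ℝ φ y u) (fderiv ℝ φ y v) (fderiv ℝ φ y w) := by
  have hφ3 : ContDiffAt ℝ 3 φ y := hφ.of_le (WithTop.coe_le_coe.2 le_top)
  have hA1 : ContDiffAt ℝ 2 (fderiv ℝ φ) y := hφ3.fderiv_right (by norm_num)
  have hA2 : ContDiffAt ℝ 1 (fderiv ℝ (fderiv ℝ φ)) y := hA1.fderiv_right (by norm_num)
  have d1 : HasFDerivAt φ (fderiv ℝ φ y) y := (hφ3.differentiableAt (by norm_num)).hasFDerivAt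
  have d2 : HasFDerivAt (fderiv ℝ φ) (fderiv ℝ (fderiv ℝ φ) y) y :=
    (hA1.differentiableAt (by norm_num)).hasFDerivAt
  have d3 : HasFDerivAt (fderiv ℝ (fderiv ℝ φ)) (fderiv ℝ (fderiv ℝ (fderiv ℝ φ)) y) y :=
    (hA2.differentiableAt (by norm_num)).hasFDerivAt
  have s2 : ∀ v w, fderiv ℝ (fderiv ℝ φ) y v w = fderiv ℝ (fderiv ℝ φ) y w v := fun v w =>
    (hφ3.isSymmSndFDerivAt (by simp [minSmoothness_of_isRCLikeNormedField]; norm_num)).eq v w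
  have s3 : ∀ v w, fderiv ℝ (fderiv ℝ (fderiv ℝ φ)) y v w =
      fderiv ℝ (fderiv ℝ (fderiv ℝ φ)) y w v := fun v w =>
    (hA1.isSymmSndFDerivAt (by simp)).eq v w
  have inv : ∀ᶠ z in 𝓝 y, (fderiv ℝ φ z).IsInvertible := by
    obtain ⟨e, he⟩ := hA
    have h1 := e.nhds
    rw [he] at h1
    exact d2.continuousAt.eventually h1
  set Y : E → E → E → E := fun v w z =>
    Γ (φ z) (fderiv ℝ φ z v) (fderiv ℝ φ z w) + fderiv ℝ (fderiv ℝ φ) z v w with hY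
  have key : ∀ v w, ∀ᶠ z in 𝓝 y, christoffel b g z v w = (fderiv ℝ φ z).inverse (Y v w z) := by
    intro v w
    filter_upwards [inv, hg.eventuallyEq_nhds, d1.continuousAt.eventually hΓ,
      (hφ3.of_le (m := 2) (by norm_num)).eventually (by simp)] with z h1 h2 h3 h4
    exact christoffel_pullback h4 h1 h3 h2 v w
  have hc : ∀ z : E, (fderiv ℝ φ z).IsInvertible → ∀ X,
      fderiv ℝ φ z ((fderiv ℝ φ z).inverse X) = X := by
    rintro z ⟨e, he⟩ X
    rw [← he]
    simp
  have c1 : ∀ v w, fderiv ℝ φ y (christoffel b g y v w) = Y v w y := fun v w => by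
    rw [(key v w).self_of_nhds, hc y hA]
  have dY : ∀ v w, HasFDerivAt (Y v w) (fderiv ℝ (Y v w) y) y ∧ ∀ u, fderiv ℝ (Y v w) y u =
      fderiv ℝ Γ (φ y) (fderiv ℝ φ y u) (fderiv ℝ φ y v) (fderiv ℝ φ y w)
      + Γ (φ y) (fderiv ℝ (fderiv ℝ φ) y u v) (fderiv ℝ φ y w)
      + Γ (φ y) (fderiv ℝ φ y v) (fderiv ℝ (fderiv ℝ φ) y u w)
      + fderiv ℝ (fderiv ℝ (fderiv ℝ φ)) y u v w := by
    intro v w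
    have e1 : HasFDerivAt (fun x => Γ (φ x)) ((fderiv ℝ Γ (φ y)).comp (fderiv ℝ φ y)) y :=
      HasFDerivAt.comp (g := Γ) y hΓd.hasFDerivAt d1
    have e2 : ∀ v, HasFDerivAt (fun x => fderiv ℝ φ x v) ((fderiv ℝ (fderiv ℝ φ) y).flip v) y := by
      intro v
      simpa using d2.clm_apply (hasFDerivAt_const v y)
    have e3 := ((d3.clm_apply (hasFDerivAt_const v y)).clm_apply (hasFDerivAt_const w y))
    have e4 := ((e1.clm_apply (e2 v)).clm_apply (e2 w)).add e3
    have e5 : HasFDerivAt (Y v w) _ y := e4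
    refine ⟨e5.differentiableAt.hasFDerivAt, fun u => ?_⟩
    rw [e5.fderiv]
    simp
    abel
  have c2 : ∀ v w u, fderiv ℝ φ y (fderiv ℝ (fun z => christoffel b g z v w) y u) =
      fderiv ℝ (Y v w) y u - fderiv ℝ (fderiv ℝ φ) y u (christoffel b g y v w) := by
    intro v w u
    have e1 : DifferentiableAt ℝ (fun z => christoffel b g z v w) y := by
      refine DifferentiableAt.congr_of_eventuallyEq ?_ (key v w)
      refine DifferentiableAt.clm_apply ?_ (dY v w).1.differentiableAt
      obtain ⟨e, he⟩ := hA
      have : DifferentiableAt ℝ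
          (ContinuousLinearMap.inverse : (E →L[ℝ] E) → (E →L[ℝ] E)) (fderiv ℝ φ y) := by
        rw [← he]
        exact (contDiffAt_map_inverse (n := 1) e).differentiableAt (by norm_num)
      exact this.comp y d2.differentiableAt
    have e2 : (fun z => fderiv ℝ φ z (christoffel b g z v w)) =ᶠ[𝓝 y] Y v w := by
      filter_upwards [key v w, inv] with z h1 h2
      rw [h1, hc z h2]
    have e3 := d2.clm_apply e1.hasFDerivAt
    have e4 := e2.fderiv_eq (𝕜 := ℝ)
    rw [e3.fderiv] at e4
    have e5 := congrArg (fun L => L u) e4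
    simp at e5
    rw [← e5]
    abel
  simp only [localCurvature, connectionCurvature, map_add, map_sub, c2, c1]
  have c3 : ∀ u v w, Y u (christoffel b g y v w) y = Γ (φ y) (fderiv ℝ φ y u)
      (Γ (φ y) (fderiv ℝ φ y v) (fderiv ℝ φ y w)) +
      Γ (φ y) (fderiv ℝ φ y u) (fderiv ℝ (fderiv ℝ φ) y v w) +
      fderiv ℝ (fderiv ℝ φ) y u (christoffel b g y v w) := by
    intro u v w
    simp only [hY]
    rw [c1]
    simp [hY]
  rw [c3, c3, (dY v w).2, (dY u w).2, s2 u v, s3 u v]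
  abel

theorem trace_eq_sum_coord (b : Basis ι ℝ E) (L : E →ₗ[ℝ] E) :
    LinearMap.trace ℝ E L = ∑ i, b.coord i (L (b i)) := by
  rw [LinearMap.trace_eq_matrix_trace ℝ b]
  simp [Matrix.trace, LinearMap.toMatrix_apply]

/-- The operator `u ↦ R(u,v)w`, whose trace is the Ricci curvature. -/
def ricciOperator (Γ : E → E →L[ℝ] E →L[ℝ] E) (x v w : E) : E →ₗ[ℝ] E where
  toFun u := connectionCurvature Γ x u v w
  map_add' u u' := by
    simp only [connectionCurvature, map_add, add_apply]
    abel
  map_smul' r u := by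
    simp only [connectionCurvature, map_smul, smul_apply, RingHom.id_apply, smul_sub, smul_add]

/-- Scalar curvature is natural under local diffeomorphisms: it is the trace of the Ricci
endomorphism `T` of the target metric. -/
theorem localScalarCurvature_pullback [CompleteSpace E] {b : Basis ι ℝ E}
    {g : E → LinearMap.BilinForm ℝ E}
    {h : E → E →L[ℝ] E →L[ℝ] ℝ} {Γ : E → E →L[ℝ] E →L[ℝ] E} {φ : E → E} {y : E}
    (hφ : ContDiffAt ℝ ∞ φ y) (hA : (fderiv ℝ φ y).IsInvertible)
    (hΓ : ∀ᶠ x in 𝓝 (φ y), IsLeviCivitaAt h Γ x) (hΓd : DifferentiableAt ℝ Γ (φ y))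
    (hg : g =ᶠ[𝓝 y] pullbackForm h φ) (T : E →ₗ[ℝ] E)
    (hT : ∀ v w, LinearMap.trace ℝ E (ricciOperator Γ (φ y) v w) = h (φ y) (T v) w) :
    localScalarCurvature b g y = LinearMap.trace ℝ E T := by
  obtain ⟨e, he⟩ := hA
  have hA : (fderiv ℝ φ y).IsInvertible := ⟨e, he⟩
  have hR : ∀ v w, localRicci b g y v w = h (φ y) (T (e v)) (e w) := by
    intro v w
    rw [← hT, ← LinearMap.trace_conj' _ e.symm.toLinearEquiv, trace_eq_sum_coord b]
    refine Finset.sum_congr rfl fun i _ => ?_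
    congr 1
    have := localCurvature_pullback (b := b) hφ hA hΓ hΓd hg (b i) v w
    rw [← he] at this
    rw [LinearEquiv.conj_apply_apply]
    exact (e.symm_apply_eq.2 this.symm).symm
  have hgy : ∀ v w, g y v w = h (φ y) (e v) (e w) := by
    intro v w
    rw [hg.self_of_nhds, pullbackForm_apply, ← he]
    rfl
  rw [← LinearMap.trace_conj' T e.symm.toLinearEquiv, trace_eq_sum_coord b]
  unfold localScalarCurvature
  refine Finset.sum_congr rfl fun i _ => ?_
  have hΓy := hΓ.self_of_nhds
  rw [Basis.coord_apply, ← sum_gram_inv_mul b (g y) (fun v w => by rw [hgy, hgy, hΓy.symm])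
    (isUnit_det_gram b _ fun v hv => ?_)]
  · refine Finset.sum_congr rfl fun j _ => ?_
    rw [hR, hgy, LinearEquiv.conj_apply_apply]
    congr 3
    exact (e.apply_symm_apply _).symm
  · refine e.map_eq_zero_iff.1 (hΓy.nondegenerate _ fun w => ?_)
    rw [← hv (e.symm w), hgy, e.apply_symm_apply]

end LeviCivita

/-! ### Products of conformally flat metrics -/

section ConformallyFlat

open scoped Topology InnerProductSpace

variable {V : Type*} [NormedAddCommGroup V] [InnerProductSpace ℝ V]

/-- The inner product as a continuous bilinear form. -/
def realInner (V : Type*) [NormedAddCommGroup V] [InnerProductSpace ℝ V] : V →L[ℝ] V →L[ℝ] ℝ :=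
  (isBoundedBilinearMap_inner (𝕜 := ℝ)).toContinuousLinearMap

theorem realInner_apply (v w : V) : realInner V v w = ⟪v, w⟫_ℝ := rfl

/-- The form `(v,w) ↦ ⟨a,v⟩w + ⟨a,w⟩v - ⟨v,w⟩a`, linear in `a`; it is the Levi-Civita connection
of the metric `e^{2f}⟨·,·⟩` if `a` is the gradient of `f`. -/
def conformalConnection (V : Type*) [NormedAddCommGroup V] [InnerProductSpace ℝ V] :
    V →L[ℝ] V →L[ℝ] V →L[ℝ] V :=
  let T : V →L[ℝ] V →L[ℝ] V →L[ℝ] V :=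
    ((ContinuousLinearMap.smulRightL ℝ V (V →L[ℝ] V)).flip (ContinuousLinearMap.id ℝ V)).comp
      (realInner V)
  T + (ContinuousLinearMap.flipₗᵢ ℝ V V V : (V →L[ℝ] V →L[ℝ] V) →L[ℝ] _).comp T
    - ((ContinuousLinearMap.compL ℝ V (V →L[ℝ] ℝ) (V →L[ℝ] V)).flip (realInner V)).comp
      (ContinuousLinearMap.smulRightL ℝ V V).flip

theorem conformalConnection_apply (a v w : V) :
    conformalConnection V a v w = ⟪a, v⟫_ℝ • w + ⟪a, w⟫_ℝ • v - ⟪v, w⟫_ℝ • a := by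
  simp [conformalConnection, realInner_apply]

/-- The metric `c⟨·,·⟩` has gradient field `a = ∇(log c)/2` near `x`. -/
structure IsConformalFactorAt (c : V → ℝ) (a : V → V) (x : V) : Prop where
  pos : 0 < c x
  hasFDerivAt : HasFDerivAt c ((2 * c x) • realInner V (a x)) x

/-- The metric `c⟨·,·⟩` has constant curvature `κ`, expressed by its gradient field `a`. -/
def HasCurvatureAt (c : V → ℝ) (a : V → V) (κ : ℝ) (x : V) : Prop :=
  ∃ l : ℝ, HasFDerivAt a ((realInner V (a x)).smulRight (a x) - l • ContinuousLinearMap.id ℝ V) x ∧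
    2 * l - ⟪a x, a x⟫_ℝ = κ * c x

theorem conformalConnection_curvature (a u v w : V) (l : ℝ) :
    conformalConnection V (⟪a, u⟫_ℝ • a - l • u) v w
      - conformalConnection V (⟪a, v⟫_ℝ • a - l • v) u w
      + conformalConnection V a u (conformalConnection V a v w)
      - conformalConnection V a v (conformalConnection V a u w)
    = (2 * l - ⟪a, a⟫_ℝ) • (⟪v, w⟫_ℝ • u - ⟪u, w⟫_ℝ • v) := by
  simp only [conformalConnection_apply, inner_sub_left, inner_smul_left,
    inner_add_right, inner_sub_right, inner_smul_right, real_inner_comm a, real_inner_comm u v,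
    RCLike.conj_to_real]
  module

variable {W : Type*} [NormedAddCommGroup W] [InnerProductSpace ℝ W]
  {E : Type*} [NormedAddCommGroup E] [NormedSpace ℝ E]

/-- `E` is the direct sum of `V` and `W`, with projections `π₁, π₂` and inclusions `i₁, i₂`. -/
structure IsDirectSum (π₁ : E →L[ℝ] V) (π₂ : E →L[ℝ] W) (i₁ : V →L[ℝ] E) (i₂ : W →L[ℝ] E) :
    Prop where
  fst_inl : ∀ v, π₁ (i₁ v) = v
  snd_inr : ∀ w, π₂ (i₂ w) = w
  fst_inr : ∀ w, π₁ (i₂ w) = 0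
  snd_inl : ∀ v, π₂ (i₁ v) = 0
  sum : ∀ x, i₁ (π₁ x) + i₂ (π₂ x) = x

theorem isDirectSum_prod : IsDirectSum (ContinuousLinearMap.fst ℝ V W)
    (ContinuousLinearMap.snd ℝ V W) (ContinuousLinearMap.inl ℝ V W)
    (ContinuousLinearMap.inr ℝ V W) :=
  ⟨by simp, by simp, by simp, by simp, by simp⟩

/-- The metric `c₁⟨·,·⟩ ⊕ c₂⟨·,·⟩`. -/
def conformalProd (π₁ : E →L[ℝ] V) (π₂ : E →L[ℝ] W) (c₁ : V → ℝ) (c₂ : W → ℝ) (x : E) :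
    E →L[ℝ] E →L[ℝ] ℝ :=
  c₁ (π₁ x) • (realInner V).bilinearComp π₁ π₁ + c₂ (π₂ x) • (realInner W).bilinearComp π₂ π₂

theorem conformalProd_apply (π₁ : E →L[ℝ] V) (π₂ : E →L[ℝ] W) (c₁ : V → ℝ) (c₂ : W → ℝ)
    (x v w : E) : conformalProd π₁ π₂ c₁ c₂ x v w =
      c₁ (π₁ x) * ⟪π₁ v, π₁ w⟫_ℝ + c₂ (π₂ x) * ⟪π₂ v, π₂ w⟫_ℝ := by
  simp [conformalProd, realInner_apply]

/-- Extension of a vector-valued bilinear map from a direct summand. -/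
def extendBilin (π : E →L[ℝ] V) (i : V →L[ℝ] E) :
    (V →L[ℝ] V →L[ℝ] V) →L[ℝ] E →L[ℝ] E →L[ℝ] E :=
  (ContinuousLinearMap.compL ℝ E (V →L[ℝ] V) (E →L[ℝ] E)
    ((ContinuousLinearMap.compL ℝ E V E i).comp
      ((ContinuousLinearMap.compL ℝ E V V).flip π))).comp
    ((ContinuousLinearMap.compL ℝ E V (V →L[ℝ] V)).flip π)

theorem extendBilin_apply (π : E →L[ℝ] V) (i : V →L[ℝ] E) (B : V →L[ℝ] V →L[ℝ] V) (v w : E) :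
    extendBilin π i B v w = i (B (π v) (π w)) := by
  simp [extendBilin]

/-- The Levi-Civita connection of `c₁⟨·,·⟩ ⊕ c₂⟨·,·⟩`, where `aᵢ = ∇(log cᵢ)/2`. -/
def conformalProdConnection (π₁ : E →L[ℝ] V) (π₂ : E →L[ℝ] W) (i₁ : V →L[ℝ] E) (i₂ : W →L[ℝ] E)
    (a₁ : V → V) (a₂ : W → W) (x : E) : E →L[ℝ] E →L[ℝ] E :=
  extendBilin π₁ i₁ (conformalConnection V (a₁ (π₁ x))) +
    extendBilin π₂ i₂ (conformalConnection W (a₂ (π₂ x)))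

variable {π₁ : E →L[ℝ] V} {π₂ : E →L[ℝ] W} {i₁ : V →L[ℝ] E} {i₂ : W →L[ℝ] E}

theorem conformalProdConnection_apply
    (a₁ : V → V) (a₂ : W → W) (x v w : E) :
    conformalProdConnection π₁ π₂ i₁ i₂ a₁ a₂ x v w =
      i₁ (conformalConnection V (a₁ (π₁ x)) (π₁ v) (π₁ w)) +
        i₂ (conformalConnection W (a₂ (π₂ x)) (π₂ v) (π₂ w)) := by
  simp [conformalProdConnection, extendBilin_apply]

theorem isLeviCivitaAt_conformalProd (hs : IsDirectSum π₁ π₂ i₁ i₂)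
    {c₁ : V → ℝ} {c₂ : W → ℝ} {a₁ : V → V} {a₂ : W → W}
    {x : E} (h₁ : IsConformalFactorAt c₁ a₁ (π₁ x)) (h₂ : IsConformalFactorAt c₂ a₂ (π₂ x)) :
    IsLeviCivitaAt (conformalProd π₁ π₂ c₁ c₂)
      (conformalProdConnection π₁ π₂ i₁ i₂ a₁ a₂) x := by
  have d₁ : HasFDerivAt (fun y => c₁ (π₁ y))
      (((2 * c₁ (π₁ x)) • realInner V (a₁ (π₁ x))).comp π₁) x :=
    HasFDerivAt.comp (g := c₁) x h₁.hasFDerivAt π₁.hasFDerivAt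
  have d₂ : HasFDerivAt (fun y => c₂ (π₂ y))
      (((2 * c₂ (π₂ x)) • realInner W (a₂ (π₂ x))).comp π₂) x :=
    HasFDerivAt.comp (g := c₂) x h₂.hasFDerivAt π₂.hasFDerivAt
  have d : HasFDerivAt (conformalProd π₁ π₂ c₁ c₂) _ x :=
    (HasFDerivAt.comp (g := ContinuousLinearMap.toSpanSingleton ℝ
      ((realInner V).bilinearComp π₁ π₁)) x (ContinuousLinearMap.hasFDerivAt _) d₁).add
    (HasFDerivAt.comp (g := ContinuousLinearMap.toSpanSingleton ℝ
      ((realInner W).bilinearComp π₂ π₂)) x (ContinuousLinearMap.hasFDerivAt _) d₂)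
  refine ⟨fun v w => ?_, fun v hv => ?_, d.differentiableAt, fun v w z => ?_⟩
  · rw [conformalProd_apply, conformalProd_apply, real_inner_comm (π₁ v), real_inner_comm (π₂ v)]
  · have h := hv v
    rw [conformalProd_apply] at h
    have e1 := mul_nonneg h₁.pos.le (real_inner_self_nonneg (x := π₁ v))
    have e2 := mul_nonneg h₂.pos.le (real_inner_self_nonneg (x := π₂ v))
    have f1 : c₁ (π₁ x) * ⟪π₁ v, π₁ v⟫_ℝ = 0 := by linarith
    have f2 : c₂ (π₂ x) * ⟪π₂ v, π₂ v⟫_ℝ = 0 := by linarith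
    have g1 : π₁ v = 0 := by simpa [h₁.pos.ne'] using f1
    have g2 : π₂ v = 0 := by simpa [h₂.pos.ne'] using f2
    rw [← hs.sum v, g1, g2, map_zero, map_zero, add_zero]
  · rw [conformalProd_apply, conformalProdConnection_apply, d.fderiv]
    simp [inner_add_left, inner_sub_left, inner_smul_left, realInner_apply,
      conformalConnection_apply, hs.fst_inl, hs.snd_inr, hs.fst_inr, hs.snd_inl]
    ring

theorem hasFDerivAt_conformalProdConnection {a₁ : V → V} {a₂ : W → W} {x : E}
    {A₁ : V →L[ℝ] V} {A₂ : W →L[ℝ] W} (h₁ : HasFDerivAt a₁ A₁ (π₁ x))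
    (h₂ : HasFDerivAt a₂ A₂ (π₂ x)) :
    HasFDerivAt (conformalProdConnection π₁ π₂ i₁ i₂ a₁ a₂)
      ((extendBilin π₁ i₁).comp ((conformalConnection V).comp (A₁.comp π₁)) +
        (extendBilin π₂ i₂).comp ((conformalConnection W).comp (A₂.comp π₂))) x := by
  have d₁ : HasFDerivAt (fun y => a₁ (π₁ y)) (A₁.comp π₁) x :=
    HasFDerivAt.comp (g := a₁) x h₁ π₁.hasFDerivAt
  have d₂ : HasFDerivAt (fun y => a₂ (π₂ y)) (A₂.comp π₂) x :=
    HasFDerivAt.comp (g := a₂) x h₂ π₂.hasFDerivAt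
  have e₁ := HasFDerivAt.comp (g := (extendBilin π₁ i₁).comp (conformalConnection V)) x
    (ContinuousLinearMap.hasFDerivAt _) d₁
  have e₂ := HasFDerivAt.comp (g := (extendBilin π₂ i₂).comp (conformalConnection W)) x
    (ContinuousLinearMap.hasFDerivAt _) d₂
  exact e₁.add e₂

theorem connectionCurvature_conformalProd (hs : IsDirectSum π₁ π₂ i₁ i₂)
    {c₁ : V → ℝ} {c₂ : W → ℝ} {a₁ : V → V} {a₂ : W → W} {κ₁ κ₂ : ℝ} {x : E}
    (h₁ : HasCurvatureAt c₁ a₁ κ₁ (π₁ x)) (h₂ : HasCurvatureAt c₂ a₂ κ₂ (π₂ x)) (u v w : E) :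
    connectionCurvature (conformalProdConnection π₁ π₂ i₁ i₂ a₁ a₂) x u v w =
      i₁ ((κ₁ * c₁ (π₁ x)) • (⟪π₁ v, π₁ w⟫_ℝ • π₁ u - ⟪π₁ u, π₁ w⟫_ℝ • π₁ v)) +
        i₂ ((κ₂ * c₂ (π₂ x)) • (⟪π₂ v, π₂ w⟫_ℝ • π₂ u - ⟪π₂ u, π₂ w⟫_ℝ • π₂ v)) := by
  obtain ⟨l₁, h₁, e₁⟩ := h₁
  obtain ⟨l₂, h₂, e₂⟩ := h₂
  rw [connectionCurvature, (hasFDerivAt_conformalProdConnection h₁ h₂).fderiv]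
  rw [← e₁, ← e₂, ← conformalConnection_curvature, ← conformalConnection_curvature]
  simp only [conformalProdConnection_apply, extendBilin_apply, ContinuousLinearMap.comp_apply,
    add_apply, map_add, map_sub, sub_apply, hs.fst_inl, hs.snd_inr, hs.fst_inr, hs.snd_inl,
    map_zero, add_zero, zero_add, ContinuousLinearMap.smulRight_apply, realInner_apply, smul_apply,
    ContinuousLinearMap.id_apply, map_smul]
  abel

/-- The Ricci endomorphism of a product of two metrics of constant curvature. -/
def ricciEndomorphism (π₁ : E →L[ℝ] V) (π₂ : E →L[ℝ] W) (i₁ : V →L[ℝ] E) (i₂ : W →L[ℝ] E)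
    (κ₁ κ₂ : ℝ) : E →ₗ[ℝ] E :=
  i₁.toLinearMap ∘ₗ ((κ₁ * (finrank ℝ V - 1)) • π₁.toLinearMap) +
    i₂.toLinearMap ∘ₗ ((κ₂ * (finrank ℝ W - 1)) • π₂.toLinearMap)

theorem trace_inclusion_comp [FiniteDimensional ℝ V] [FiniteDimensional ℝ E] {π : E →L[ℝ] V}
    {i : V →L[ℝ] E} (h : ∀ v, π (i v) = v) (L : V →ₗ[ℝ] V) :
    LinearMap.trace ℝ E (i.toLinearMap ∘ₗ (L ∘ₗ π.toLinearMap)) = LinearMap.trace ℝ V L := by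
  rw [LinearMap.trace_comp_comm']
  congr 1
  ext v
  simp [h]

theorem trace_ricciOperator_conformalProd [FiniteDimensional ℝ V] [FiniteDimensional ℝ W]
    [FiniteDimensional ℝ E] (hs : IsDirectSum π₁ π₂ i₁ i₂)
    {c₁ : V → ℝ} {c₂ : W → ℝ} {a₁ : V → V} {a₂ : W → W} {κ₁ κ₂ : ℝ} {x : E}
    (h₁ : HasCurvatureAt c₁ a₁ κ₁ (π₁ x)) (h₂ : HasCurvatureAt c₂ a₂ κ₂ (π₂ x)) (v w : E) :
    LinearMap.trace ℝ E (ricciOperator (conformalProdConnection π₁ π₂ i₁ i₂ a₁ a₂) x v w) =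
      conformalProd π₁ π₂ c₁ c₂ x (ricciEndomorphism π₁ π₂ i₁ i₂ κ₁ κ₂ v) w := by
  have h : ricciOperator (conformalProdConnection π₁ π₂ i₁ i₂ a₁ a₂) x v w =
      i₁.toLinearMap ∘ₗ (((κ₁ * c₁ (π₁ x)) • (⟪π₁ v, π₁ w⟫_ℝ • (LinearMap.id : V →ₗ[ℝ] V) -
        ((innerₗ V).flip (π₁ w)).smulRight (π₁ v))) ∘ₗ π₁.toLinearMap) +
      i₂.toLinearMap ∘ₗ (((κ₂ * c₂ (π₂ x)) • (⟪π₂ v, π₂ w⟫_ℝ • (LinearMap.id : W →ₗ[ℝ] W) -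
        ((innerₗ W).flip (π₂ w)).smulRight (π₂ v))) ∘ₗ π₂.toLinearMap) := by
    refine LinearMap.ext fun u => ?_
    exact connectionCurvature_conformalProd hs h₁ h₂ u v w
  rw [h, map_add, trace_inclusion_comp hs.fst_inl, trace_inclusion_comp hs.snd_inr,
    conformalProd_apply]
  simp [LinearMap.trace_smulRight, inner_smul_left, real_inner_comm (π₁ v),
    real_inner_comm (π₂ v), ricciEndomorphism, hs.fst_inl, hs.snd_inr, hs.fst_inr, hs.snd_inl]
  ring

/-- The scalar curvature of a metric which is locally isometric to a product of two conformally
flat metrics of constant curvature. -/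
theorem localScalarCurvature_of_conformalProd [FiniteDimensional ℝ V] [FiniteDimensional ℝ W]
    [FiniteDimensional ℝ E] (hs : IsDirectSum π₁ π₂ i₁ i₂)
    {ι : Type*} [Fintype ι] [DecidableEq ι] {b : Basis ι ℝ E}
    {g : E → LinearMap.BilinForm ℝ E} {φ : E → E} {y : E}
    {c₁ : V → ℝ} {c₂ : W → ℝ} {a₁ : V → V} {a₂ : W → W} {κ₁ κ₂ : ℝ}
    (hφ : ContDiffAt ℝ ∞ φ y) (hA : (fderiv ℝ φ y).IsInvertible)
    (h₁ : ∀ᶠ x in 𝓝 (π₁ (φ y)), IsConformalFactorAt c₁ a₁ x)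
    (h₂ : ∀ᶠ x in 𝓝 (π₂ (φ y)), IsConformalFactorAt c₂ a₂ x)
    (k₁ : HasCurvatureAt c₁ a₁ κ₁ (π₁ (φ y))) (k₂ : HasCurvatureAt c₂ a₂ κ₂ (π₂ (φ y)))
    (hg : ∀ᶠ z in 𝓝 y, ∀ v w, g z v w =
      c₁ (π₁ (φ z)) * ⟪π₁ (fderiv ℝ φ z v), π₁ (fderiv ℝ φ z w)⟫_ℝ +
        c₂ (π₂ (φ z)) * ⟪π₂ (fderiv ℝ φ z v), π₂ (fderiv ℝ φ z w)⟫_ℝ) :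
    localScalarCurvature b g y = κ₁ * (finrank ℝ V - 1) * finrank ℝ V
      + κ₂ * (finrank ℝ W - 1) * finrank ℝ W := by
  have : CompleteSpace E := FiniteDimensional.complete ℝ _
  have hΓd : DifferentiableAt ℝ (conformalProdConnection π₁ π₂ i₁ i₂ a₁ a₂) (φ y) := by
    obtain ⟨l₁, k₁, -⟩ := k₁
    obtain ⟨l₂, k₂, -⟩ := k₂
    exact (hasFDerivAt_conformalProdConnection k₁ k₂).differentiableAt
  have hg' : g =ᶠ[𝓝 y] pullbackForm (conformalProd π₁ π₂ c₁ c₂) φ := by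
    filter_upwards [hg] with z hz
    refine LinearMap.ext₂ fun v w => ?_
    rw [hz, pullbackForm_apply, conformalProd_apply]
  rw [localScalarCurvature_pullback hφ hA ?_ hΓd hg' _
    (trace_ricciOperator_conformalProd hs k₁ k₂), ricciEndomorphism, map_add,
    LinearMap.trace_comp_comm', LinearMap.trace_comp_comm' _ i₂.toLinearMap]
  · have e₁ : π₁.toLinearMap ∘ₗ i₁.toLinearMap = LinearMap.id := LinearMap.ext hs.fst_inl
    have e₂ : π₂.toLinearMap ∘ₗ i₂.toLinearMap = LinearMap.id := LinearMap.ext hs.snd_inr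
    simp [LinearMap.smul_comp, e₁, e₂]
  · filter_upwards [π₁.continuous.continuousAt.eventually h₁,
      π₂.continuous.continuousAt.eventually h₂] with x e₁ e₂
    exact isLeviCivitaAt_conformalProd hs e₁ e₂

end ConformallyFlat

end

noncomputable section

/-! ### The conformal factors of the round and the hyperbolic metric -/

section Factors

open scoped InnerProductSpace

variable {V : Type*} [NormedAddCommGroup V] [InnerProductSpace ℝ V]

/-- The conformal factor of the round metric in stereographic coordinates. -/
def roundFactor (x : V) : ℝ := 16 / (‖x‖ ^ 2 + 4) ^ 2

/-- Half the gradient of the logarithm of `roundFactor`. -/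
def roundGradient (x : V) : V := (-2 / (‖x‖ ^ 2 + 4)) • x

theorem hasFDerivAt_norm_sq_add_four (x : V) :
    HasFDerivAt (fun y : V => ‖y‖ ^ 2 + 4) ((2 : ℝ) • realInner V x) x := by
  refine (((hasStrictFDerivAt_norm_sq x).hasFDerivAt).add_const 4).congr_fderiv ?_
  ext v
  simp [realInner_apply]

theorem HasFDerivAt.real_inv {f : V → ℝ} {f' : V →L[ℝ] ℝ} {x : V} (hf : HasFDerivAt f f' x)
    (hx : f x ≠ 0) : HasFDerivAt (fun y => (f y)⁻¹) ((-(f x ^ 2)⁻¹) • f') x :=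
  (hasDerivAt_inv hx).comp_hasFDerivAt x hf

theorem isConformalFactorAt_round (x : V) : IsConformalFactorAt roundFactor roundGradient x := by
  have hq : (0 : ℝ) < ‖x‖ ^ 2 + 4 := by positivity
  refine ⟨by unfold roundFactor; positivity, ?_⟩
  have h := (((hasFDerivAt_norm_sq_add_four x).pow 2).real_inv (by positivity)).const_mul 16
  have h' : HasFDerivAt (roundFactor : V → ℝ) _ x := h
  refine h'.congr_fderiv (Eq.symm ?_)
  ext v
  simp [roundFactor, roundGradient, realInner_apply]
  field_simp

theorem hasCurvatureAt_round (x : V) : HasCurvatureAt roundFactor roundGradient 1 x := by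
  have hq : (0 : ℝ) < ‖x‖ ^ 2 + 4 := by positivity
  refine ⟨2 / (‖x‖ ^ 2 + 4), ?_, ?_⟩
  · have h := (((hasFDerivAt_norm_sq_add_four x).real_inv hq.ne').const_mul (-2)).smul (hasFDerivAt_id x)
    have h' : HasFDerivAt (roundGradient : V → V) _ x := h
    refine h'.congr_fderiv (Eq.symm ?_)
    ext v
    simp [roundGradient, realInner_apply, smul_smul]
    match_scalars <;> field_simp
  · simp only [roundGradient, roundFactor, inner_smul_left, inner_smul_right,
      real_inner_self_eq_norm_sq, RCLike.conj_to_real]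
    field_simp
    ring

/-- The conformal factor of the hyperbolic metric in the upper half-space. -/
def hyperbolicFactor {k : ℕ} (x : EuclideanSpace ℝ (Fin (k + 1))) : ℝ := 1 / (x 0) ^ 2

/-- Half the gradient of the logarithm of `hyperbolicFactor`. -/
def hyperbolicGradient {k : ℕ} (x : EuclideanSpace ℝ (Fin (k + 1))) :
    EuclideanSpace ℝ (Fin (k + 1)) :=
  (-(x 0)⁻¹) • EuclideanSpace.single 0 1

theorem hasFDerivAt_apply_zero {k : ℕ} (x : EuclideanSpace ℝ (Fin (k + 1))) :
    HasFDerivAt (fun y : EuclideanSpace ℝ (Fin (k + 1)) => y 0)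
      (EuclideanSpace.proj (0 : Fin (k + 1)) : EuclideanSpace ℝ (Fin (k + 1)) →L[ℝ] ℝ) x :=
  (EuclideanSpace.proj (0 : Fin (k + 1)) : EuclideanSpace ℝ (Fin (k + 1)) →L[ℝ] ℝ).hasFDerivAt

theorem isConformalFactorAt_hyperbolic {k : ℕ} {x : EuclideanSpace ℝ (Fin (k + 1))}
    (hx : 0 < x 0) : IsConformalFactorAt hyperbolicFactor hyperbolicGradient x := by
  refine ⟨by unfold hyperbolicFactor; positivity, ?_⟩
  have h := ((hasFDerivAt_apply_zero x).pow 2).real_inv (by positivity)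
  have hf : (fun y : EuclideanSpace ℝ (Fin (k + 1)) => (y 0 ^ 2)⁻¹) = hyperbolicFactor := by
    funext y
    simp [hyperbolicFactor]
  rw [hf] at h
  refine h.congr_fderiv (Eq.symm ?_)
  ext v
  simp [hyperbolicFactor, hyperbolicGradient, realInner_apply,
    EuclideanSpace.inner_single_left]
  field_simp

theorem hasCurvatureAt_hyperbolic {k : ℕ} {x : EuclideanSpace ℝ (Fin (k + 1))} (hx : 0 < x 0) :
    HasCurvatureAt hyperbolicFactor hyperbolicGradient (-1) x := by
  refine ⟨0, ?_, ?_⟩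
  · have h := (((hasFDerivAt_apply_zero x).real_inv hx.ne').neg).smul_const
      (EuclideanSpace.single 0 1 : EuclideanSpace ℝ (Fin (k + 1)))
    have h' : HasFDerivAt (hyperbolicGradient : EuclideanSpace ℝ (Fin (k + 1)) → _) _ x := h
    refine h'.congr_fderiv (Eq.symm ?_)
    ext v i
    simp [hyperbolicGradient, realInner_apply, EuclideanSpace.inner_single_left]
    field_simp
  · simp [hyperbolicGradient, hyperbolicFactor, norm_smul]

/-- The inverse of stereographic projection pulls the flat metric back to the round factor. -/
theorem inner_fderiv_stereoInv {W : Type*} [NormedAddCommGroup W] [InnerProductSpace ℝ W]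
    (U : W →ₗᵢ[ℝ] V) (n : V) (hn : ‖n‖ = 1) (hU : ∀ w, ⟪n, U w⟫_ℝ = 0) (y v w : W) :
    ⟪fderiv ℝ (fun x => stereoInvFunAux n (U x)) y v,
      fderiv ℝ (fun x => stereoInvFunAux n (U x)) y w⟫_ℝ = roundFactor y * ⟪v, w⟫_ℝ := by
  have hq : (0 : ℝ) < ‖y‖ ^ 2 + 4 := by positivity
  have h1 : HasFDerivAt (fun x : W => (‖x‖ ^ 2 + 4)⁻¹) _ y :=
    (hasFDerivAt_norm_sq_add_four y).real_inv hq.ne'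
  have h2 : HasFDerivAt (fun x : W => (4 : ℝ) • U x) _ y :=
    (U.toContinuousLinearMap.hasFDerivAt (x := y)).const_smul (4 : ℝ)
  have h3 : HasFDerivAt (fun x : W => (‖x‖ ^ 2 + 4 - 8) • n) _ y :=
    ((hasFDerivAt_norm_sq_add_four y).sub_const 8).smul_const n
  have h4 := h1.smul (h2.add h3)
  have hf : (fun x : W => (‖x‖ ^ 2 + 4)⁻¹) • ((fun x => (4 : ℝ) • U x) +
      fun x => (‖x‖ ^ 2 + 4 - 8) • n) = fun x => stereoInvFunAux n (U x) := by
    funext x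
    simp only [stereoInvFunAux, U.norm_map, Pi.smul_apply', Pi.add_apply]
    congr 3
    ring
  rw [hf] at h4
  have h5 : ∀ v, fderiv ℝ (fun x => stereoInvFunAux n (U x)) y v =
      (4 / (‖y‖ ^ 2 + 4)) • U v - (8 * ⟪y, v⟫_ℝ / (‖y‖ ^ 2 + 4) ^ 2) • U y
        + (16 * ⟪y, v⟫_ℝ / (‖y‖ ^ 2 + 4) ^ 2) • n := by
    intro v
    rw [h4.fderiv]
    simp [realInner_apply, smul_smul]
    match_scalars <;> field_simp <;> ring
  have hU' : ∀ w, ⟪U w, n⟫_ℝ = 0 := fun w => by rw [real_inner_comm, hU]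
  rw [h5, h5]
  simp only [inner_add_left, inner_sub_left, inner_smul_left, inner_add_right, inner_sub_right,
    inner_smul_right, U.inner_map_map, hU, hU', real_inner_self_eq_norm_sq, hn,
    RCLike.conj_to_real, real_inner_comm y v, roundFactor]
  field_simp
  ring

end Factors

/-! ### Chart coefficients -/

section Charts

open scoped Topology

variable {E : Type*} [NormedAddCommGroup E] [NormedSpace ℝ E]
  {H : Type*} [TopologicalSpace H] {I : ModelWithCorners ℝ E H}
  {M : Type*} [TopologicalSpace M] [ChartedSpace H M]
  {F : Type*} [NormedAddCommGroup F] [NormedSpace ℝ F]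
  {G : Type*} [TopologicalSpace G] {J : ModelWithCorners ℝ F G}
  {N : Type*} [TopologicalSpace N] [ChartedSpace G N]
  {E' : Type*} [NormedAddCommGroup E'] [NormedSpace ℝ E']
  {H' : Type*} [TopologicalSpace H'] {K : ModelWithCorners ℝ E' H'}
  {P : Type*} [TopologicalSpace P] [ChartedSpace H' P]

theorem TwoTensor.pullback_apply (g : TwoTensor J N) (f : M → N) (x : M)
    (v w : TangentSpace I x) :
    TwoTensor.pullback I g f x v w = g (f x) (mfderiv I J f x v) (mfderiv I J f x w) := rfl

theorem TwoTensor.pullback_comp (g : TwoTensor K P) {f : N → P} {h : M → N} {x : M}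
    (hf : MDifferentiableAt J K f (h x)) (hh : MDifferentiableAt I J h x) :
    TwoTensor.pullback I g (f ∘ h) x =
      TwoTensor.pullback I (TwoTensor.pullback J g f) h x := by
  refine LinearMap.ext₂ fun v w => ?_
  rw [TwoTensor.pullback_apply, TwoTensor.pullback_apply, TwoTensor.pullback_apply,
    mfderiv_comp x hf hh]
  rfl

theorem TwoTensor.pullback_congr (g : TwoTensor J N) {f f' : M → N} {x : M}
    (h : f =ᶠ[𝓝 x] f') : TwoTensor.pullback I g f x = TwoTensor.pullback I g f' x := by
  unfold TwoTensor.pullback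
  rw [h.mfderiv_eq, h.self_of_nhds]

theorem TwoTensor.prod_apply (g : TwoTensor I M) (h : TwoTensor J N) (p : M × N)
    (v w : TangentSpace (I.prod J) p) :
    g.prod h p v w = g p.1 v.1 w.1 + h p.2 v.2 w.2 := by
  simp only [TwoTensor.prod, LinearMap.add_apply, TwoTensor.pullback_apply, mfderiv_fst,
    mfderiv_snd]
  rfl

theorem mdifferentiableAt_extChartAt_symm [I.Boundaryless] [IsManifold I ∞ M] {x : M} {y : E}
    (hy : y ∈ (extChartAt I x).target) :
    MDifferentiableAt 𝓘(ℝ, E) I (extChartAt I x).symm y :=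
  ((contMDiffOn_extChartAt_symm (n := ∞) x).contMDiffAt
    ((isOpen_extChartAt_target x).mem_nhds hy)).mdifferentiableAt (by simp)

theorem chartCoefficients_prod [I.Boundaryless] [J.Boundaryless] [IsManifold I ∞ M]
    [IsManifold J ∞ N] (g : TwoTensor I M) (h : TwoTensor J N) (p : M × N) {y : E × F}
    (hy₁ : y.1 ∈ (extChartAt I p.1).target) (hy₂ : y.2 ∈ (extChartAt J p.2).target)
    (v w : E × F) :
    chartCoefficients (g.prod h) p y v w =
      chartCoefficients g p.1 y.1 v.1 w.1 + chartCoefficients h p.2 y.2 v.2 w.2 := by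
  have hsymm : ((extChartAt (I.prod J) p).symm : E × F → M × N) =
      Prod.map (extChartAt I p.1).symm (extChartAt J p.2).symm := by
    rw [extChartAt_prod]
    rfl
  have h1 := mdifferentiableAt_extChartAt_symm hy₁
  have h2 := mdifferentiableAt_extChartAt_symm hy₂
  have h3 : mfderiv 𝓘(ℝ, E × F) (I.prod J) (extChartAt (I.prod J) p).symm y =
      (mfderiv 𝓘(ℝ, E) I (extChartAt I p.1).symm y.1).prodMap
        (mfderiv 𝓘(ℝ, F) J (extChartAt J p.2).symm y.2) := by
    rw [hsymm, modelWithCornersSelf_prod, ← chartedSpaceSelf_prod]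
    exact mfderiv_prodMap h1 h2
  change g.prod h ((extChartAt (I.prod J) p).symm y) (mfderiv _ _ _ y v) (mfderiv _ _ _ y w) = _
  rw [TwoTensor.prod_apply, h3, hsymm]
  rfl

theorem chartCoefficients_apply [FiniteDimensional ℝ E] (g : TwoTensor I M) (x : M) (y v w : E) :
    chartCoefficients g x y v w = g ((extChartAt I x).symm y)
      (mfderiv 𝓘(ℝ, E) I (extChartAt I x).symm y v)
      (mfderiv 𝓘(ℝ, E) I (extChartAt I x).symm y w) := rfl

end Charts

section Models

open scoped Topology InnerProductSpace

theorem flatMetric_pullback_apply {d : ℕ} {E : Type*} [NormedAddCommGroup E] [NormedSpace ℝ E]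
    (f : E → EuclideanSpace ℝ (Fin d)) (y v w : E) :
    TwoTensor.pullback 𝓘(ℝ, E) (flatMetric d) f y v w = ⟪fderiv ℝ f y v, fderiv ℝ f y w⟫_ℝ := by
  change flatMetric d (f y) (mfderiv 𝓘(ℝ, E) (𝓡 d) f y v) (mfderiv 𝓘(ℝ, E) (𝓡 d) f y w) = _
  rw [mfderiv_eq_fderiv]
  rfl

theorem chartCoefficients_roundMetric (d : ℕ) (x : UnitSphere d)
    (y v w : EuclideanSpace ℝ (Fin d)) :
    chartCoefficients (roundMetric d) x y v w = roundFactor y * ⟪v, w⟫_ℝ := by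
  have hfact : Fact (finrank ℝ (EuclideanSpace ℝ (Fin (d + 1))) = d + 1) :=
    ⟨finrank_euclideanSpace_fin⟩
  have hy : y ∈ (extChartAt (𝓡 d) x).target := by
    rw [extChartAt_target]
    have : (chartAt (EuclideanSpace ℝ (Fin d)) x).target = Set.univ := stereographic'_target (-x)
    simp [this]
  have hI : IsManifold (𝓡 d) ∞ (UnitSphere d) := inferInstance
  have h1 := mdifferentiableAt_extChartAt_symm hy
  have h2 : MDifferentiableAt (𝓡 d) (𝓡 (d + 1)) (Subtype.val : UnitSphere d → _)
      ((extChartAt (𝓡 d) x).symm y) :=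
    (contMDiff_coe_sphere (m := ∞)).mdifferentiableAt (by simp)
  have h3 := TwoTensor.pullback_comp (flatMetric (d + 1)) h2 h1
  let U := (OrthonormalBasis.fromOrthogonalSpanSingleton (𝕜 := ℝ) d
    (ne_zero_of_mem_unit_sphere (-x))).repr
  have h4 : (Subtype.val ∘ (extChartAt (𝓡 d) x).symm) = fun z =>
      stereoInvFunAux (-x).val (((Submodule.subtypeₗᵢ _).comp U.symm.toLinearIsometry) z) := by
    funext z
    have := stereographic'_symm_apply (n := d) (-x) z
    simp only [extChartAt, mfld_simps]
    refine this.trans ?_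
    have hn : ‖(U.symm z : EuclideanSpace ℝ (Fin (d + 1)))‖ = ‖z‖ := U.symm.norm_map z
    change (‖(U.symm z : EuclideanSpace ℝ (Fin (d + 1)))‖ ^ 2 + 4)⁻¹ • (4 : ℝ) • (U.symm z).val +
      (‖(U.symm z : EuclideanSpace ℝ (Fin (d + 1)))‖ ^ 2 + 4)⁻¹ •
      (‖(U.symm z : EuclideanSpace ℝ (Fin (d + 1)))‖ ^ 2 - 4) • (-x).val = _
    rw [← smul_add]
    rfl
  change TwoTensor.pullback _ (TwoTensor.pullback (𝓡 d) (flatMetric (d + 1)) Subtype.val) _ y v w = _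
  rw [← h3, h4, flatMetric_pullback_apply]
  refine inner_fderiv_stereoInv _ _ (norm_eq_of_mem_sphere (-x)) (fun w => ?_) y v w
  exact Submodule.mem_orthogonal_singleton_iff_inner_right.1 (U.symm w).2

/-- In a chart, a metric covered by hyperbolic space is locally the pullback of the hyperbolic
metric of the upper half-space by a local diffeomorphism `ψ`. -/
theorem exists_chartCoefficients_eq_hyperbolic {k : ℕ} {S : Type*} [TopologicalSpace S]
    [ChartedSpace (EuclideanSpace ℝ (Fin (k + 1))) S] [IsManifold (𝓡 (k + 1)) ∞ S]
    {g : TwoTensor (𝓡 (k + 1)) S} {p : upperHalfSpace k → S}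
    (hp : IsRiemannianCovering (hyperbolicMetric k) g p)
    (hpos : ∀ s (v : TangentSpace (𝓡 (k + 1)) s), v ≠ 0 → 0 < g s v v)
    (s : S) {y : EuclideanSpace ℝ (Fin (k + 1))} (hy : y ∈ (extChartAt (𝓡 (k + 1)) s).target) :
    ∃ ψ : EuclideanSpace ℝ (Fin (k + 1)) → EuclideanSpace ℝ (Fin (k + 1)),
      ContDiffAt ℝ ∞ ψ y ∧ (fderiv ℝ ψ y).IsInvertible ∧ 0 < ψ y 0 ∧
      ∀ᶠ z in 𝓝 y, ∀ v w, chartCoefficients g s z v w =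
        hyperbolicFactor (ψ z) * ⟪fderiv ℝ ψ z v, fderiv ℝ ψ z w⟫_ℝ := by
  obtain ⟨⟨-, hsurj, hloc⟩, hpull⟩ := hp
  obtain ⟨t, ht⟩ := hsurj ((extChartAt (𝓡 (k + 1)) s).symm y)
  have htl := hloc t
  set q := htl.localInverse with hq
  set φ := (extChartAt (𝓡 (k + 1)) s).symm with hφ
  have hφs : ∀ z ∈ (extChartAt (𝓡 (k + 1)) s).target,
      ContMDiffAt (𝓡 (k + 1)) (𝓡 (k + 1)) ∞ φ z := fun z hz =>
    (contMDiffOn_extChartAt_symm (n := ∞) s).contMDiffAt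
      ((isOpen_extChartAt_target s).mem_nhds hz)
  have hqs : ∀ s' ∈ q.source, ContMDiffAt (𝓡 (k + 1)) (𝓡 (k + 1)) ∞ q s' := fun s' hs' =>
    htl.localInverse_contMDiffOn.contMDiffAt (q.open_source.mem_nhds hs')
  have hyq : φ y ∈ q.source := ht ▸ htl.localInverse_mem_source
  have hev : ∀ᶠ z in 𝓝 y, z ∈ (extChartAt (𝓡 (k + 1)) s).target ∧ φ z ∈ q.source :=
    ((isOpen_extChartAt_target s).eventually_mem hy).and
      ((hφs y hy).continuousAt.eventually (q.open_source.eventually_mem hyq))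
  have hr : ∀ z ∈ (extChartAt (𝓡 (k + 1)) s).target, φ z ∈ q.source →
      ContMDiffAt (𝓡 (k + 1)) (𝓡 (k + 1)) ∞ (q ∘ φ) z := fun z hz hz' =>
    (hqs _ hz').comp z (hφs z hz)
  have hval : ∀ u : upperHalfSpace k, ContMDiffAt (𝓡 (k + 1)) (𝓡 (k + 1)) ∞
      (Subtype.val : upperHalfSpace k → _) u := fun u => contMDiff_subtype_val.contMDiffAt
  have hψ : ContDiffAt ℝ ∞ (Subtype.val ∘ (q ∘ φ)) y :=
    contMDiffAt_iff_contDiffAt.1 ((hval _).comp y (hr y hy hyq))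
  have key : ∀ᶠ z in 𝓝 y, ∀ v w, chartCoefficients g s z v w =
        hyperbolicFactor ((Subtype.val ∘ (q ∘ φ)) z) *
          ⟪fderiv ℝ (Subtype.val ∘ (q ∘ φ)) z v, fderiv ℝ (Subtype.val ∘ (q ∘ φ)) z w⟫_ℝ := by
    filter_upwards [hev.eventually_nhds] with z hz v w
    obtain ⟨hz1, hz2⟩ := hz.self_of_nhds
    have e1 : φ =ᶠ[𝓝 z] p ∘ (q ∘ φ) := by
      filter_upwards [hz] with z' hz'
      exact (htl.localInverse_right_inv hz'.2).symm
    have e2 : chartCoefficients g s z = TwoTensor.pullback (𝓡 (k + 1)) g φ z := rfl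
    rw [e2, TwoTensor.pullback_congr g e1, TwoTensor.pullback_comp g
      (hloc.contMDiff.contMDiffAt.mdifferentiableAt (by simp))
      ((hr z hz1 hz2).mdifferentiableAt (by simp)), hpull, ← flatMetric_pullback_apply,
      TwoTensor.pullback_comp (flatMetric (k + 1)) ((hval _).mdifferentiableAt (by simp))
        ((hr z hz1 hz2).mdifferentiableAt (by simp))]
    rfl
  refine ⟨Subtype.val ∘ (q ∘ φ), hψ, ?_, (q (φ y)).2, key⟩
  have hinj : Function.Injective (fderiv ℝ (Subtype.val ∘ (q ∘ φ)) y) := by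
    rw [injective_iff_map_eq_zero]
    intro v hv
    by_contra hne
    have h1 := key.self_of_nhds v v
    rw [hv, inner_zero_left, mul_zero, chartCoefficients_apply] at h1
    refine (hpos _ _ ?_).ne' h1
    have h2 := isInvertible_mfderivWithin_extChartAt_symm hy
    rw [ModelWithCorners.range_eq_univ, mfderivWithin_univ] at h2
    obtain ⟨e, he⟩ := h2
    rw [← he]
    exact fun h => hne (e.map_eq_zero_iff.1 h)
  refine ⟨(LinearEquiv.ofInjectiveEndo (fderiv ℝ (Subtype.val ∘ (q ∘ φ)) y).toLinearMap
    hinj).toContinuousLinearEquiv, ?_⟩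
  ext v
  rfl

variable {m k : ℕ} {S : Type*} [TopologicalSpace S]
  [ChartedSpace (EuclideanSpace ℝ (Fin (k + 1))) S]
  {g : TwoTensor (𝓡 (k + 1)) S} {p : upperHalfSpace k → S}

theorem mem_target_of_mem_extChartAt_prod (x : UnitSphere m × S)
    {y : EuclideanSpace ℝ (Fin m) × EuclideanSpace ℝ (Fin (k + 1))}
    (hy : y ∈ (extChartAt ((𝓡 m).prod (𝓡 (k + 1))) x).target) :
    y.1 ∈ (extChartAt (𝓡 m) x.1).target ∧ y.2 ∈ (extChartAt (𝓡 (k + 1)) x.2).target := by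
  rwa [extChartAt_prod, PartialEquiv.prod_target] at hy

theorem roundMetric_pos (d : ℕ) (x : UnitSphere d) (v : TangentSpace (𝓡 d) x) (hv : v ≠ 0) :
    0 < roundMetric d x v v := by
  have hfact : Fact (finrank ℝ (EuclideanSpace ℝ (Fin (d + 1))) = d + 1) :=
    ⟨finrank_euclideanSpace_fin⟩
  refine (real_inner_self_pos (F := EuclideanSpace ℝ (Fin (d + 1)))).2 fun h => hv ?_
  exact (injective_iff_map_eq_zero _).1 (injective_mvfderiv_subtypeVal_sphere (n := d) x) v h

theorem roundMetric_symm (d : ℕ) (x : UnitSphere d) (v w : TangentSpace (𝓡 d) x) :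
    roundMetric d x v w = roundMetric d x w v :=
  real_inner_comm (F := EuclideanSpace ℝ (Fin (d + 1)))
    (mfderiv (𝓡 d) (𝓡 (d + 1)) Subtype.val x w) (mfderiv (𝓡 d) (𝓡 (d + 1)) Subtype.val x v)

theorem bilinForm_nonneg {V : Type*} [AddCommGroup V] [Module ℝ V] {B : LinearMap.BilinForm ℝ V}
    (hB : ∀ v, v ≠ 0 → 0 < B v v) (v : V) : 0 ≤ B v v := by
  by_cases h : v = 0
  · simp [h]
  · exact (hB v h).le

theorem roundMetric_prod_pos
    (hpos : ∀ s (v : TangentSpace (𝓡 (k + 1)) s), v ≠ 0 → 0 < g s v v) (x : UnitSphere m × S)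
    (v : TangentSpace ((𝓡 m).prod (𝓡 (k + 1))) x) (hv : v ≠ 0) :
    0 < (roundMetric m).prod g x v v := by
  rw [TwoTensor.prod_apply]
  have h1 := bilinForm_nonneg (roundMetric_pos m x.1) v.1
  have h2 := bilinForm_nonneg (hpos x.2) v.2
  by_cases h : v.1 = 0
  · have h' : v.2 ≠ 0 := fun h' => hv (Prod.ext h h')
    linarith [hpos x.2 _ h']
  · linarith [roundMetric_pos m x.1 _ h]

theorem roundMetric_prod_symm
    (hsymm : ∀ s (v w : TangentSpace (𝓡 (k + 1)) s), g s v w = g s w v) (x : UnitSphere m × S)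
    (v w : TangentSpace ((𝓡 m).prod (𝓡 (k + 1))) x) :
    (roundMetric m).prod g x v w = (roundMetric m).prod g x w v := by
  rw [TwoTensor.prod_apply, TwoTensor.prod_apply]
  exact congrArg₂ (· + ·) (roundMetric_symm m x.1 _ _) (hsymm x.2 _ _)

variable [IsManifold (𝓡 (k + 1)) ∞ S]

/-- In a chart, the product of the round metric with a metric covered by hyperbolic space is
locally the pullback of a product of conformally flat metrics by a local diffeomorphism. -/
theorem exists_chartCoefficients_eq_conformalProd
    (hp : IsRiemannianCovering (hyperbolicMetric k) g p)
    (hpos : ∀ s (v : TangentSpace (𝓡 (k + 1)) s), v ≠ 0 → 0 < g s v v)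
    (x : UnitSphere m × S) {y : EuclideanSpace ℝ (Fin m) × EuclideanSpace ℝ (Fin (k + 1))}
    (hy : y ∈ (extChartAt ((𝓡 m).prod (𝓡 (k + 1))) x).target) :
    ∃ φ : EuclideanSpace ℝ (Fin m) × EuclideanSpace ℝ (Fin (k + 1)) →
        EuclideanSpace ℝ (Fin m) × EuclideanSpace ℝ (Fin (k + 1)),
      ContDiffAt ℝ ∞ φ y ∧ (fderiv ℝ φ y).IsInvertible ∧ 0 < (φ y).2 0 ∧
      ∀ᶠ z in 𝓝 y, ∀ v w, chartCoefficients ((roundMetric m).prod g) x z v w =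
        roundFactor (φ z).1 * ⟪(fderiv ℝ φ z v).1, (fderiv ℝ φ z w).1⟫_ℝ +
        hyperbolicFactor (φ z).2 * ⟪(fderiv ℝ φ z v).2, (fderiv ℝ φ z w).2⟫_ℝ := by
  obtain ⟨hy₁, hy₂⟩ := mem_target_of_mem_extChartAt_prod x hy
  obtain ⟨ψ, hψ, ⟨e, he⟩, hψ0, hψg⟩ := exists_chartCoefficients_eq_hyperbolic hp hpos x.2 hy₂
  have hφ : ContDiffAt ℝ ∞ (Prod.map id ψ) y :=
    ContDiffAt.prodMap' (f := id) (p := y) contDiffAt_id hψ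
  have hd : ∀ z : EuclideanSpace ℝ (Fin m) × EuclideanSpace ℝ (Fin (k + 1)),
      DifferentiableAt ℝ ψ z.2 → fderiv ℝ (Prod.map id ψ) z =
        (ContinuousLinearMap.id ℝ _).prodMap (fderiv ℝ ψ z.2) := fun z hz =>
    (HasFDerivAt.prodMap (f := id) (p := z) (hasFDerivAt_id _) hz.hasFDerivAt).fderiv
  refine ⟨Prod.map id ψ, hφ, ?_, hψ0, ?_⟩
  · rw [hd y (hψ.differentiableAt (by simp)), ← he]
    exact ⟨(ContinuousLinearEquiv.refl ℝ _).prodCongr e, rfl⟩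
  · have hdiff : ∀ᶠ z in 𝓝 y.2, DifferentiableAt ℝ ψ z := by
      filter_upwards [(hψ.of_le (m := 1) (by norm_num)).eventually (by simp)] with z hz
      exact hz.differentiableAt (by norm_num)
    filter_upwards [(isOpen_extChartAt_target x).eventually_mem hy,
      continuousAt_snd.eventually hψg, continuousAt_snd.eventually hdiff] with z hz h1 h2 v w
    obtain ⟨hz₁, hz₂⟩ := mem_target_of_mem_extChartAt_prod x hz
    rw [chartCoefficients_prod _ _ x hz₁ hz₂, chartCoefficients_roundMetric, h1, hd z h2]
    rfl

theorem scalarCurvature_roundMetric_prod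
    (hp : IsRiemannianCovering (hyperbolicMetric k) g p)
    (hpos : ∀ s (v : TangentSpace (𝓡 (k + 1)) s), v ≠ 0 → 0 < g s v v) (x : UnitSphere m × S) :
    scalarCurvature ((roundMetric m).prod g) x = (m - 1) * m - k * (k + 1) := by
  obtain ⟨φ, h1, h2, h3, h4⟩ := exists_chartCoefficients_eq_conformalProd hp hpos x
    (mem_extChartAt_target x)
  have h5 : ∀ᶠ z : EuclideanSpace ℝ (Fin (k + 1)) in
      𝓝 (φ (extChartAt ((𝓡 m).prod (𝓡 (k + 1))) x x)).2, 0 < z 0 :=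
    (upperHalfSpace k).isOpen.eventually_mem h3
  have h6 := localScalarCurvature_of_conformalProd isDirectSum_prod
    (b := finBasis ℝ (EuclideanSpace ℝ (Fin m) × EuclideanSpace ℝ (Fin (k + 1)))) h1 h2
    (Filter.Eventually.of_forall isConformalFactorAt_round)
    (h5.mono fun z hz => isConformalFactorAt_hyperbolic hz)
    (hasCurvatureAt_round _) (hasCurvatureAt_hyperbolic h3) h4
  rw [scalarCurvature, h6, finrank_euclideanSpace_fin, finrank_euclideanSpace_fin]
  push_cast
  ring

theorem continuousOn_chartCoefficients_roundMetric_prod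
    (hp : IsRiemannianCovering (hyperbolicMetric k) g p)
    (hpos : ∀ s (v : TangentSpace (𝓡 (k + 1)) s), v ≠ 0 → 0 < g s v v)
    (x : UnitSphere m × S) (v w : EuclideanSpace ℝ (Fin m) × EuclideanSpace ℝ (Fin (k + 1))) :
    ContinuousOn (fun y => chartCoefficients ((roundMetric m).prod g) x y v w)
      (extChartAt ((𝓡 m).prod (𝓡 (k + 1))) x).target := by
  intro y hy
  obtain ⟨φ, h1, h2, h3, h4⟩ := exists_chartCoefficients_eq_conformalProd hp hpos x hy
  refine ContinuousAt.continuousWithinAt ?_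
  refine ContinuousAt.congr ?_ (h4.mono fun z hz => (hz v w).symm)
  have c1 : ContinuousAt φ y := h1.continuousAt
  have c2 : ∀ v, ContinuousAt (fun z => fderiv ℝ φ z v) y := fun v =>
    (h1.continuousAt_fderiv (by simp)).clm_apply continuousAt_const
  refine (ContinuousAt.mul ?_ ((c2 v).fst.inner (c2 w).fst)).add
    (ContinuousAt.mul ?_ ((c2 v).snd.inner (c2 w).snd))
  · exact ContinuousAt.comp (f := fun z => (φ z).1)
      (isConformalFactorAt_round _).hasFDerivAt.continuousAt c1.fst
  · exact ContinuousAt.comp (f := fun z => (φ z).2)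
      (isConformalFactorAt_hyperbolic h3).hasFDerivAt.continuousAt c1.snd

end Models
end

noncomputable section

/-! ### The dual metric -/

section Cometric

variable {E : Type*} [NormedAddCommGroup E] [NormedSpace ℝ E]
  {ι : Type*} [Fintype ι] [DecidableEq ι]

/-- The squared length `B^{ij} ℓ_i ℓ_j` of a covector. -/
def cometric (b : Basis ι ℝ E) (B : LinearMap.BilinForm ℝ E) (l : E →L[ℝ] ℝ) : ℝ :=
  ∑ i, ∑ j, (gram b B)⁻¹ i j * l (b i) * l (b j)

theorem gram_det_comp (b : Basis ι ℝ E) (B : LinearMap.BilinForm ℝ E) (A : E →ₗ[ℝ] E) :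
    (gram b (B.compl₁₂ A A)).det = (LinearMap.det A) ^ 2 * (gram b B).det := by
  have h : ∀ B, gram b B = LinearMap.BilinForm.toMatrix b B := by
    intro B
    ext i j
    simp [gram, LinearMap.BilinForm.toMatrix_apply]
  have h2 : B.compl₁₂ A A = B.comp A A := rfl
  rw [h, h, h2, LinearMap.BilinForm.toMatrix_comp b b, Matrix.det_mul, Matrix.det_mul,
    Matrix.det_transpose, LinearMap.det_toMatrix]
  ring

theorem isUnit_det_gram_of_pos (b : Basis ι ℝ E) {B : LinearMap.BilinForm ℝ E}
    (hpos : ∀ v, v ≠ 0 → 0 < B v v) : IsUnit (gram b B).det :=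
  isUnit_det_gram b B fun v hv => by
    by_contra h
    exact (hpos v h).ne' (hv v)

theorem gram_det_pos (b : Basis ι ℝ E) {B : LinearMap.BilinForm ℝ E}
    (hsymm : ∀ v w, B v w = B w v) (hpos : ∀ v, v ≠ 0 → 0 < B v v) : 0 < (gram b B).det := by
  refine Matrix.PosDef.det_pos (Matrix.PosDef.of_dotProduct_mulVec_pos ?_ ?_)
  · ext i j
    simp [gram, hsymm (b i)]
  · intro x hx
    have hne : ∑ i, x i • b i ≠ 0 := fun h0 =>
      hx (funext fun i => Fintype.linearIndependent_iff.1 b.linearIndependent x h0 i)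
    have := hpos _ hne
    simp only [map_sum, map_smul, LinearMap.sum_apply, LinearMap.smul_apply, smul_eq_mul] at this
    simp only [dotProduct, Matrix.mulVec, gram, Matrix.of_apply, star_trivial, Finset.mul_sum]
    rw [Finset.sum_comm]
    refine this.trans_eq (Finset.sum_congr rfl fun i _ => ?_)
    rw [Finset.mul_sum]
    exact Finset.sum_congr rfl fun j _ => by ring

theorem cometric_eq_of_riesz (b : Basis ι ℝ E) {B : LinearMap.BilinForm ℝ E} {l : E →L[ℝ] ℝ}
    (hsymm : ∀ v w, B v w = B w v) (hpos : ∀ v, v ≠ 0 → 0 < B v v) {w : E}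
    (hw : ∀ z, B w z = l z) : cometric b B l = l w := by
  have h1 : ∀ i, ∑ j, (gram b B)⁻¹ i j * l (b i) * l (b j) = b.repr w i * l (b i) := by
    intro i
    rw [← sum_gram_inv_mul b B hsymm (isUnit_det_gram_of_pos b hpos) w i, Finset.sum_mul]
    refine Finset.sum_congr rfl fun j _ => ?_
    rw [hw]
    ring
  simp only [cometric, h1]
  conv_rhs => rw [← b.sum_repr w, map_sum]
  exact Finset.sum_congr rfl fun i _ => by rw [map_smul, smul_eq_mul]

theorem exists_riesz [FiniteDimensional ℝ E] {B : LinearMap.BilinForm ℝ E}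
    (hpos : ∀ v, v ≠ 0 → 0 < B v v) (l : E →L[ℝ] ℝ) : ∃ w, ∀ z, B w z = l z := by
  have hinj : Function.Injective B := by
    rw [injective_iff_map_eq_zero]
    intro v hv
    by_contra h
    have := hpos v h
    rw [hv] at this
    simp at this
  have hsurj := (LinearMap.injective_iff_surjective_of_finrank_eq_finrank
    (by rw [Subspace.dual_finrank_eq])).1 hinj
  obtain ⟨w, hw⟩ := hsurj l.toLinearMap
  exact ⟨w, fun z => by rw [hw]; rfl⟩

theorem cometric_comp [FiniteDimensional ℝ E] (b : Basis ι ℝ E) {B B' : LinearMap.BilinForm ℝ E}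
    {l l' : E →L[ℝ] ℝ}
    (hsymm : ∀ v w, B v w = B w v) (hpos : ∀ v, v ≠ 0 → 0 < B v v) (A : E ≃L[ℝ] E)
    (hB : ∀ v w, B' v w = B (A v) (A w)) (hl : ∀ v, l' v = l (A v)) :
    cometric b B' l' = cometric b B l := by
  obtain ⟨w, hw⟩ := exists_riesz hpos l
  rw [cometric_eq_of_riesz b hsymm hpos hw, cometric_eq_of_riesz (w := A.symm w) b
    (fun v w => by rw [hB, hB, hsymm])
    (fun v hv => by rw [hB]; exact hpos _ (by simpa using hv)) (fun z => by rw [hB, hl]; simp [hw]),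
    hl, A.apply_symm_apply]

theorem cometric_nonneg [FiniteDimensional ℝ E] (b : Basis ι ℝ E) {B : LinearMap.BilinForm ℝ E}
    (hsymm : ∀ v w, B v w = B w v) (hpos : ∀ v, v ≠ 0 → 0 < B v v) (l : E →L[ℝ] ℝ) :
    0 ≤ cometric b B l := by
  obtain ⟨w, hw⟩ := exists_riesz hpos l
  rw [cometric_eq_of_riesz b hsymm hpos hw, ← hw]
  exact bilinForm_nonneg hpos w

theorem norm_sq_le_cometric [FiniteDimensional ℝ E] (b : Basis ι ℝ E)
    {B : LinearMap.BilinForm ℝ E} (hsymm : ∀ v w, B v w = B w v) (hpos : ∀ v, v ≠ 0 → 0 < B v v)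
    {Λ : ℝ} (hΛ : 0 ≤ Λ) (hB : ∀ v, B v v ≤ Λ * ‖v‖ ^ 2) (l : E →L[ℝ] ℝ) :
    ‖l‖ ^ 2 ≤ Λ * cometric b B l := by
  have h0 := cometric_nonneg b hsymm hpos l
  obtain ⟨w, hw⟩ := exists_riesz hpos l
  have h1 : ∀ v, l v ^ 2 ≤ cometric b B l * B v v := by
    intro v
    rw [cometric_eq_of_riesz b hsymm hpos hw, ← hw, ← hw]
    exact LinearMap.BilinForm.apply_sq_le_of_symm B (bilinForm_nonneg hpos)
      ⟨fun v w => by simpa using hsymm v w⟩ w v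
  have h2 : ‖l‖ ≤ √(Λ * cometric b B l) := by
    refine l.opNorm_le_bound (Real.sqrt_nonneg _) fun v => ?_
    rw [Real.norm_eq_abs, ← Real.sqrt_sq (norm_nonneg v), ← Real.sqrt_mul (by positivity)]
    refine Real.abs_le_sqrt ((h1 v).trans ?_)
    calc cometric b B l * B v v ≤ cometric b B l * (Λ * ‖v‖ ^ 2) :=
          mul_le_mul_of_nonneg_left (hB v) h0
      _ = Λ * cometric b B l * ‖v‖ ^ 2 := by ring
  calc ‖l‖ ^ 2 ≤ √(Λ * cometric b B l) ^ 2 := by gcongr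
    _ = Λ * cometric b B l := Real.sq_sqrt (by positivity)

end Cometric

/-! ### The Riemannian volume measure -/

section Volume

open scoped Topology ENNReal

variable {E : Type*} [NormedAddCommGroup E] [NormedSpace ℝ E] [FiniteDimensional ℝ E]
  {H : Type*} [TopologicalSpace H] {I : ModelWithCorners ℝ E H} [I.Boundaryless]
  {M : Type*} [TopologicalSpace M] [ChartedSpace H M] [IsManifold I ∞ M]

theorem contDiffAt_chartTransition {x₀ x₁ : M} {y : E} (hy : y ∈ (extChartAt I x₀).target)
    (hy' : (extChartAt I x₀).symm y ∈ (extChartAt I x₁).source) :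
    ContDiffAt ℝ ∞ (extChartAt I x₁ ∘ (extChartAt I x₀).symm) y := by
  rw [← contMDiffAt_iff_contDiffAt]
  rw [extChartAt_source] at hy'
  exact (contMDiffAt_extChartAt' hy').comp y ((contMDiffOn_extChartAt_symm x₀).contMDiffAt
    ((isOpen_extChartAt_target x₀).mem_nhds hy))

theorem chartCoefficients_transition (g : TwoTensor I M) {x₀ x₁ : M} {y : E}
    (hy : y ∈ (extChartAt I x₀).target)
    (hy' : (extChartAt I x₀).symm y ∈ (extChartAt I x₁).source) :
    chartCoefficients g x₀ y =
      (chartCoefficients g x₁ (extChartAt I x₁ ((extChartAt I x₀).symm y))).compl₁₂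
        (fderiv ℝ (extChartAt I x₁ ∘ (extChartAt I x₀).symm) y).toLinearMap
        (fderiv ℝ (extChartAt I x₁ ∘ (extChartAt I x₀).symm) y).toLinearMap := by
  have h1 : (extChartAt I x₀).symm =ᶠ[𝓝 y]
      (extChartAt I x₁).symm ∘ (extChartAt I x₁ ∘ (extChartAt I x₀).symm) := by
    have hc : ContinuousAt (extChartAt I x₀).symm y := continuousAt_extChartAt_symm'' hy
    filter_upwards [hc.eventually ((isOpen_extChartAt_source x₁).eventually_mem hy')] with z hz
    exact ((extChartAt I x₁).left_inv hz).symm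
  have h2 := TwoTensor.pullback_comp (I := 𝓘(ℝ, E)) (J := 𝓘(ℝ, E)) g
    (f := (extChartAt I x₁).symm) (h := extChartAt I x₁ ∘ (extChartAt I x₀).symm) (x := y)
    (mdifferentiableAt_extChartAt_symm ((extChartAt I x₁).map_source hy'))
    ((contDiffAt_chartTransition hy hy').differentiableAt (by simp)).mdifferentiableAt
  have h3 : chartCoefficients g x₀ y = _ := (TwoTensor.pullback_congr g h1).trans h2
  rw [h3, ← mfderiv_eq_fderiv]
  rfl

theorem chartCoefficients_pos {g : TwoTensor I M}
    (hpos : ∀ x (v : TangentSpace I x), v ≠ 0 → 0 < g x v v) {x : M} {y : E}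
    (hy : y ∈ (extChartAt I x).target) (v : E) (hv : v ≠ 0) :
    0 < chartCoefficients g x y v v := by
  rw [chartCoefficients_apply]
  refine hpos _ _ ?_
  have h2 := isInvertible_mfderivWithin_extChartAt_symm hy
  rw [ModelWithCorners.range_eq_univ, mfderivWithin_univ] at h2
  obtain ⟨e, he⟩ := h2
  rw [← he]
  exact fun h => hv (e.map_eq_zero_iff.1 h)

theorem gradNormSq_eq_cometric {g : TwoTensor I M}
    (hsymm : ∀ x (v w : TangentSpace I x), g x v w = g x w v)
    (hpos : ∀ x (v : TangentSpace I x), v ≠ 0 → 0 < g x v v) {u : M → ℝ}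
    (hu : ContMDiff I 𝓘(ℝ, ℝ) ∞ u) {x : M} {y : E} (hy : y ∈ (extChartAt I x).target) :
    gradNormSq g u ((extChartAt I x).symm y) =
      cometric (finBasis ℝ E) (chartCoefficients g x y)
        (fderiv ℝ (u ∘ (extChartAt I x).symm) y) := by
  have h2 := isInvertible_mfderivWithin_extChartAt_symm hy
  rw [ModelWithCorners.range_eq_univ, mfderivWithin_univ] at h2
  obtain ⟨e, he⟩ := h2
  have h3 : fderiv ℝ (u ∘ (extChartAt I x).symm) y =
      (mfderiv I 𝓘(ℝ, ℝ) u ((extChartAt I x).symm y)).comp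
        (mfderiv 𝓘(ℝ, E) I (extChartAt I x).symm y) := by
    rw [← mfderiv_eq_fderiv]
    exact mfderiv_comp y (hu.mdifferentiableAt (by simp)) (mdifferentiableAt_extChartAt_symm hy)
  symm
  refine cometric_comp (finBasis ℝ E) (B := g ((extChartAt I x).symm y)) (hsymm _) (hpos _) e ?_ ?_
  · intro v w
    rw [chartCoefficients_apply, ← he]
    rfl
  · intro v
    rw [h3, ← he]
    rfl

variable [MeasurableSpace E] [BorelSpace E] [MeasurableSpace M] [BorelSpace M]

/-- The density of the Riemannian volume in the chart at `x`. -/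
def chartDensity (g : TwoTensor I M) (x : M) (y : E) : ℝ :=
  √(gram (finBasis ℝ E) (chartCoefficients g x y)).det

theorem measurableSet_target_inter_preimage (x : M) {A : Set M} (hA : MeasurableSet A) :
    MeasurableSet ((extChartAt I x).target ∩ (extChartAt I x).symm ⁻¹' A) := by
  have h1 : Measurable ((extChartAt I x).target.domRestrict (extChartAt I x).symm) :=
    (continuousOn_iff_continuous_domRestrict.1 (continuousOn_extChartAt_symm x)).measurable
  have h2 := (isOpen_extChartAt_target (I := I) x).measurableSet.subtype_image (h1 hA)
  convert h2 using 1
  ext y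
  constructor
  · rintro ⟨h, h'⟩
    exact ⟨⟨y, h⟩, h', rfl⟩
  · rintro ⟨⟨z, h⟩, h', rfl⟩
    exact ⟨h, h'⟩

theorem aemeasurable_extChartAt_symm (g : TwoTensor I M) (x : M) :
    AEMeasurable (extChartAt I x).symm
      (((finBasis ℝ E).addHaar.restrict (extChartAt I x).target).withDensity fun y =>
        ENNReal.ofReal √(gram (finBasis ℝ E) (chartCoefficients g x y)).det) :=
  ((continuousOn_extChartAt_symm x).aemeasurable
    (isOpen_extChartAt_target x).measurableSet).mono_ac (withDensity_absolutelyContinuous _ _)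

theorem chartVolume_apply (g : TwoTensor I M) (x : M) {A : Set M} (hA : MeasurableSet A) :
    chartVolume g x A = ∫⁻ y in (extChartAt I x).target ∩ (extChartAt I x).symm ⁻¹' A,
      ENNReal.ofReal (chartDensity g x y) ∂(finBasis ℝ E).addHaar := by
  rw [chartVolume, Measure.map_apply_of_aemeasurable (aemeasurable_extChartAt_symm g x) hA,
    withDensity_apply', Measure.restrict_restrict' (isOpen_extChartAt_target x).measurableSet,
    Set.inter_comm]
  rfl

theorem chartVolume_eq_of_subset (g : TwoTensor I M) (x₀ x₁ : M) {A : Set M}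
    (hA : MeasurableSet A) (h₀ : A ⊆ (extChartAt I x₀).source)
    (h₁ : A ⊆ (extChartAt I x₁).source) : chartVolume g x₀ A = chartVolume g x₁ A := by
  set τ := extChartAt I x₁ ∘ (extChartAt I x₀).symm with hτ
  set T := (extChartAt I x₀).target ∩ (extChartAt I x₀).symm ⁻¹' A with hT
  have him : τ '' T = (extChartAt I x₁).target ∩ (extChartAt I x₁).symm ⁻¹' A := by
    ext z
    constructor
    · rintro ⟨y, ⟨hy, hyA⟩, rfl⟩
      refine ⟨(extChartAt I x₁).map_source (h₁ hyA), ?_⟩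
      simp only [hτ, Set.mem_preimage, Function.comp_apply]
      rwa [(extChartAt I x₁).left_inv (h₁ hyA)]
    · rintro ⟨hz, hzA⟩
      refine ⟨extChartAt I x₀ ((extChartAt I x₁).symm z), ⟨(extChartAt I x₀).map_source (h₀ hzA),
        ?_⟩, ?_⟩
      · rw [Set.mem_preimage, (extChartAt I x₀).left_inv (h₀ hzA)]
        exact hzA
      · simp only [hτ, Function.comp_apply]
        rw [(extChartAt I x₀).left_inv (h₀ hzA), (extChartAt I x₁).right_inv hz]
  have hinj : Set.InjOn τ T := by
    rintro y ⟨hy, hyA⟩ z ⟨hz, hzA⟩ h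
    exact (extChartAt I x₀).symm.injOn hy hz ((extChartAt I x₁).injOn (h₁ hyA) (h₁ hzA) h)
  rw [chartVolume_apply g x₀ hA, chartVolume_apply g x₁ hA, ← him,
    lintegral_image_eq_lintegral_abs_det_fderiv_mul _ (measurableSet_target_inter_preimage x₀ hA)
      (f' := fun y => fderiv ℝ τ y) (fun y hy => ((contDiffAt_chartTransition hy.1
        (h₁ hy.2)).differentiableAt (by simp)).hasFDerivAt.hasFDerivWithinAt) hinj]
  refine setLIntegral_congr_fun (measurableSet_target_inter_preimage x₀ hA) fun y hy => ?_
  rw [← ENNReal.ofReal_mul (abs_nonneg _)]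
  congr 1
  rw [chartDensity, chartDensity, chartCoefficients_transition g hy.1 (h₁ hy.2), gram_det_comp,
    Real.sqrt_mul (sq_nonneg _), Real.sqrt_sq_eq_abs]
  rfl

theorem chartVolume_inter_source (g : TwoTensor I M) (x : M) {A : Set M} (hA : MeasurableSet A) :
    chartVolume g x (A ∩ (extChartAt I x).source) = chartVolume g x A := by
  rw [chartVolume_apply g x hA,
    chartVolume_apply g x (hA.inter (isOpen_extChartAt_source x).measurableSet)]
  congr 2
  ext y
  constructor
  · rintro ⟨h1, h2⟩
    exact ⟨h1, h2.1⟩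
  · rintro ⟨h1, h2⟩
    exact ⟨h1, h2, (extChartAt I x).map_target h1⟩

theorem riemannianVolume_eq_chartVolume (g : TwoTensor I M) (x : M) {A : Set M}
    (hA : MeasurableSet A) (h : A ⊆ (extChartAt I x).source) :
    riemannianVolume g A = chartVolume g x A := by
  have hs : MeasurableSet (extChartAt I x).source := (isOpen_extChartAt_source x).measurableSet
  apply le_antisymm
  · have h1 : riemannianVolume g ≤ (chartVolume g x).restrict (extChartAt I x).source +
        (riemannianVolume g).restrict (extChartAt I x).sourceᶜ := by
      refine iSup_le fun z => ?_
      rw [Measure.le_iff]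
      intro B hB
      rw [Measure.add_apply, Measure.restrict_apply hB, Measure.restrict_apply hB,
        ← measure_inter_add_sdiff B hs]
      refine add_le_add ?_ (le_iSup (fun z => chartVolume g z) z _)
      rw [← chartVolume_inter_source g z (hB.inter hs), chartVolume_eq_of_subset g z x
        ((hB.inter hs).inter (isOpen_extChartAt_source z).measurableSet) Set.inter_subset_right
        (Set.inter_subset_left.trans Set.inter_subset_right)]
      exact measure_mono Set.inter_subset_left
    refine (h1 A).trans ?_
    rw [Measure.add_apply, Measure.restrict_apply hA, Measure.restrict_apply hA,
      Set.inter_eq_left.2 h, ← Set.sdiff_eq, Set.sdiff_eq_empty.2 h, measure_empty, add_zero]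
  · exact le_iSup (fun z => chartVolume g z) x A

theorem restrict_riemannianVolume (g : TwoTensor I M) (x : M) {U : Set M}
    (hU : MeasurableSet U) (h : U ⊆ (extChartAt I x).source) :
    (riemannianVolume g).restrict U = (chartVolume g x).restrict U := by
  ext A hA
  rw [Measure.restrict_apply hA, Measure.restrict_apply hA,
    riemannianVolume_eq_chartVolume g x (hA.inter hU) (Set.inter_subset_right.trans h)]

theorem aemeasurable_chartDensity {g : TwoTensor I M} {x : M}
    (hc : ContinuousOn (chartDensity g x) (extChartAt I x).target) :
    AEMeasurable (fun y => ENNReal.ofReal (chartDensity g x y))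
      ((finBasis ℝ E).addHaar.restrict (extChartAt I x).target) :=
  (hc.aemeasurable (isOpen_extChartAt_target x).measurableSet).ennreal_ofReal

/-- Integration against the Riemannian volume in a chart. -/
theorem setLIntegral_riemannianVolume {g : TwoTensor I M} {x : M}
    (hc : ContinuousOn (chartDensity g x) (extChartAt I x).target) {T : Set E}
    (hT : T ⊆ (extChartAt I x).target) (hU : MeasurableSet ((extChartAt I x).symm '' T))
    {f : M → ℝ≥0∞} (hf : Measurable f) :
    ∫⁻ z in (extChartAt I x).symm '' T, f z ∂riemannianVolume g =
      ∫⁻ y in T, f ((extChartAt I x).symm y) * ENNReal.ofReal (chartDensity g x y)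
        ∂(finBasis ℝ E).addHaar := by
  have hsub : (extChartAt I x).symm '' T ⊆ (extChartAt I x).source := by
    rintro _ ⟨y, hy, rfl⟩
    exact (extChartAt I x).map_target (hT hy)
  have hpre : (extChartAt I x).target ∩ (extChartAt I x).symm ⁻¹' ((extChartAt I x).symm '' T)
      = T := by
    ext y
    constructor
    · rintro ⟨h1, z, hz, hzy⟩
      rwa [← (extChartAt I x).symm.injOn (hT hz) h1 hzy]
    · exact fun h => ⟨hT h, y, h, rfl⟩
  have hTm := measurableSet_target_inter_preimage (I := I) x hU
  rw [hpre] at hTm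
  rw [restrict_riemannianVolume g x hU hsub, ← lintegral_indicator hU, chartVolume,
    lintegral_map' (hf.indicator hU).aemeasurable (aemeasurable_extChartAt_symm g x)]
  refine (lintegral_withDensity_eq_lintegral_mul₀ (aemeasurable_chartDensity hc)
    ((hf.indicator hU).comp_aemeasurable ((continuousOn_extChartAt_symm x).aemeasurable
      (isOpen_extChartAt_target x).measurableSet))).trans ?_
  rw [← lintegral_indicator hTm, ← lintegral_indicator (isOpen_extChartAt_target x).measurableSet]
  refine lintegral_congr fun y => ?_
  by_cases hy : y ∈ (extChartAt I x).target
  · by_cases hyT : y ∈ T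
    · have : (extChartAt I x).symm y ∈ (extChartAt I x).symm '' T := ⟨y, hyT, rfl⟩
      rw [Set.indicator_of_mem hy, Set.indicator_of_mem hyT, Pi.mul_apply, Function.comp_apply,
        Set.indicator_of_mem this, mul_comm]
    · have : (extChartAt I x).symm y ∉ (extChartAt I x).symm '' T := fun h =>
        hyT (hpre.le ⟨hy, h⟩)
      rw [Set.indicator_of_mem hy, Set.indicator_of_notMem hyT, Pi.mul_apply, Function.comp_apply,
        Set.indicator_of_notMem this, mul_zero]
  · have hyT : y ∉ T := fun h => hy (hT h)
    rw [Set.indicator_of_notMem hy, Set.indicator_of_notMem hyT]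

end Volume
end

noncomputable section

/-! ### Positivity of the Yamabe constant -/

section Sobolev

open scoped Topology ENNReal NNReal

variable {E : Type*} [NormedAddCommGroup E] [NormedSpace ℝ E] [FiniteDimensional ℝ E]
  {H : Type*} [TopologicalSpace H] {I : ModelWithCorners ℝ E H} [I.Boundaryless]
  {M : Type*} [TopologicalSpace M] [ChartedSpace H M] [IsManifold I ∞ M]

/-- A positive definite symmetric two-tensor whose chart coefficients are continuous. -/
structure IsContinuousMetric (g : TwoTensor I M) : Prop where
  symm : ∀ x (v w : TangentSpace I x), g x v w = g x w v
  pos : ∀ x (v : TangentSpace I x), v ≠ 0 → 0 < g x v v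
  continuousOn : ∀ x v w,
    ContinuousOn (fun y => chartCoefficients g x y v w) (extChartAt I x).target

variable {g : TwoTensor I M}

theorem IsContinuousMetric.continuousOn_gram (hg : IsContinuousMetric g) (x : M) :
    ContinuousOn (fun y => gram (finBasis ℝ E) (chartCoefficients g x y))
      (extChartAt I x).target :=
  continuousOn_pi.2 fun _ => continuousOn_pi.2 fun _ => hg.continuousOn x _ _

theorem IsContinuousMetric.chart_symm (hg : IsContinuousMetric g) (x : M) (y v w : E) :
    chartCoefficients g x y v w = chartCoefficients g x y w v :=
  hg.symm _ _ _

theorem IsContinuousMetric.det_pos (hg : IsContinuousMetric g) {x : M} {y : E}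
    (hy : y ∈ (extChartAt I x).target) :
    0 < (gram (finBasis ℝ E) (chartCoefficients g x y)).det :=
  gram_det_pos _ (hg.chart_symm x y) (chartCoefficients_pos hg.pos hy)

theorem IsContinuousMetric.continuousOn_chartDensity (hg : IsContinuousMetric g) (x : M) :
    ContinuousOn (chartDensity g x) (extChartAt I x).target :=
  Real.continuous_sqrt.comp_continuousOn
    ((Continuous.matrix_det continuous_id).comp_continuousOn (hg.continuousOn_gram x))

theorem IsContinuousMetric.chartDensity_pos (hg : IsContinuousMetric g) {x : M} {y : E}
    (hy : y ∈ (extChartAt I x).target) : 0 < chartDensity g x y :=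
  Real.sqrt_pos.2 (hg.det_pos hy)

theorem IsContinuousMetric.gradNormSq_nonneg (hg : IsContinuousMetric g) (u : M → ℝ) (x : M) :
    0 ≤ gradNormSq g u x :=
  cometric_nonneg (finBasis ℝ E) (hg.symm x) (hg.pos x) _

theorem contDiffAt_comp_extChartAt_symm {u : M → ℝ} (hu : ContMDiff I 𝓘(ℝ, ℝ) ∞ u) {x : M} {y : E}
    (hy : y ∈ (extChartAt I x).target) : ContDiffAt ℝ ∞ (u ∘ (extChartAt I x).symm) y :=
  contMDiffAt_iff_contDiffAt.1 (hu.contMDiffAt.comp y ((contMDiffOn_extChartAt_symm x).contMDiffAt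
    ((isOpen_extChartAt_target x).mem_nhds hy)))

theorem IsContinuousMetric.continuous_gradNormSq (hg : IsContinuousMetric g) {u : M → ℝ}
    (hu : ContMDiff I 𝓘(ℝ, ℝ) ∞ u) : Continuous (gradNormSq g u) := by
  rw [continuous_iff_continuousAt]
  intro x
  have h1 : gradNormSq g u =ᶠ[𝓝 x] (fun y => cometric (finBasis ℝ E) (chartCoefficients g x y)
      (fderiv ℝ (u ∘ (extChartAt I x).symm) y)) ∘ extChartAt I x := by
    filter_upwards [extChartAt_source_mem_nhds (I := I) x] with z hz
    rw [Function.comp_apply, ← gradNormSq_eq_cometric hg.symm hg.pos hu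
      ((extChartAt I x).map_source hz), (extChartAt I x).left_inv hz]
  refine ContinuousAt.congr ?_ h1.symm
  refine ContinuousAt.comp ?_ (continuousAt_extChartAt x)
  have hy := mem_extChartAt_target (I := I) x
  have hn := extChartAt_target_mem_nhds (I := I) x
  have hG : ContinuousAt (fun y => gram (finBasis ℝ E) (chartCoefficients g x y))
      (extChartAt I x x) := (hg.continuousOn_gram x).continuousAt hn
  have hGi : ContinuousAt (fun y => (gram (finBasis ℝ E) (chartCoefficients g x y))⁻¹)
      (extChartAt I x x) := by
    simp only [Matrix.inv_def, Ring.inverse_eq_inv']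
    have h1 : ContinuousAt (fun y => (gram (finBasis ℝ E) (chartCoefficients g x y)).det⁻¹)
        (extChartAt I x x) :=
      ContinuousAt.inv₀ (((Continuous.matrix_det continuous_id).continuousAt).comp hG)
        (hg.det_pos hy).ne'
    have h2 : ContinuousAt (fun y => (gram (finBasis ℝ E) (chartCoefficients g x y)).adjugate)
        (extChartAt I x x) := ((Continuous.matrix_adjugate continuous_id).continuousAt).comp hG
    exact h1.smul h2
  have hD : ∀ v, ContinuousAt (fun y => fderiv ℝ (u ∘ (extChartAt I x).symm) y v)
      (extChartAt I x x) := fun v =>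
    ((contDiffAt_comp_extChartAt_symm hu hy).continuousAt_fderiv (by simp)).clm_apply
      continuousAt_const
  unfold cometric
  refine tendsto_finsetSum _ fun i _ => tendsto_finsetSum _ fun j _ => ?_
  exact ((continuousAt_pi.1 (continuousAt_pi.1 hGi i) j).mul (hD _)).mul (hD _)

theorem IsContinuousMetric.exists_bounds (hg : IsContinuousMetric g) (x : M) {K : Set E}
    (hK : IsCompact K) (hKt : K ⊆ (extChartAt I x).target) :
    ∃ D d Λ : ℝ, 0 < D ∧ 0 < d ∧ 0 < Λ ∧ ∀ y ∈ K, chartDensity g x y ≤ D ∧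
      d ≤ chartDensity g x y ∧ ∀ v, chartCoefficients g x y v v ≤ Λ * ‖v‖ ^ 2 := by
  obtain ⟨D, hD⟩ := hK.exists_bound_of_continuousOn ((hg.continuousOn_chartDensity x).mono hKt)
  have hinv : ContinuousOn (fun y => (chartDensity g x y)⁻¹) K :=
    ((hg.continuousOn_chartDensity x).mono hKt).inv₀ fun y hy => (hg.chartDensity_pos (hKt hy)).ne'
  obtain ⟨d, hd⟩ := hK.exists_bound_of_continuousOn hinv
  have hB : ∀ i j, ∃ C, ∀ y ∈ K,
      ‖chartCoefficients g x y (finBasis ℝ E i) (finBasis ℝ E j)‖ ≤ C := fun i j =>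
    hK.exists_bound_of_continuousOn ((hg.continuousOn x _ _).mono hKt)
  choose C hC using hB
  let c : Fin (finrank ℝ E) → ℝ := fun i =>
    ‖LinearMap.toContinuousLinearMap ((finBasis ℝ E).coord i)‖
  have hc : ∀ i v, |(finBasis ℝ E).repr v i| ≤ c i * ‖v‖ := fun i v =>
    (LinearMap.toContinuousLinearMap ((finBasis ℝ E).coord i)).le_opNorm v
  refine ⟨|D| + 1, (|d| + 1)⁻¹, |∑ i, ∑ j, c i * c j * C i j| + 1, by positivity, by positivity,
    by positivity, fun y hy => ⟨?_, ?_, fun v => ?_⟩⟩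
  · have := hD y hy
    rw [Real.norm_eq_abs] at this
    linarith [le_abs_self (chartDensity g x y), le_abs_self D]
  · have h1 := hd y hy
    have h2 := hg.chartDensity_pos (hKt hy)
    rw [Real.norm_eq_abs] at h1
    rw [inv_le_comm₀ (by positivity) h2]
    linarith [le_abs_self (chartDensity g x y)⁻¹, le_abs_self d]
  · have h1 : chartCoefficients g x y v v = ∑ i, ∑ j, (finBasis ℝ E).repr v i *
        ((finBasis ℝ E).repr v j *
          chartCoefficients g x y (finBasis ℝ E i) (finBasis ℝ E j)) := by
      conv_lhs => rw [← (finBasis ℝ E).sum_repr v]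
      simp only [map_sum, map_smul, LinearMap.sum_apply, LinearMap.smul_apply, smul_eq_mul,
        Finset.mul_sum]
      rw [Finset.sum_comm]
      exact Finset.sum_congr rfl fun i _ => Finset.sum_congr rfl fun j _ => by ring
    have h2 : chartCoefficients g x y v v ≤ (∑ i, ∑ j, c i * c j * C i j) * ‖v‖ ^ 2 := by
      rw [h1, Finset.sum_mul]
      refine Finset.sum_le_sum fun i _ => ?_
      rw [Finset.sum_mul]
      refine Finset.sum_le_sum fun j _ => ?_
      refine (le_abs_self _).trans ?_
      rw [abs_mul, abs_mul]
      calc _ ≤ (c i * ‖v‖) * ((c j * ‖v‖) * C i j) :=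
            mul_le_mul (hc i v) (mul_le_mul (hc j v) (hC i j y hy) (abs_nonneg _)
              (mul_nonneg (norm_nonneg _) (norm_nonneg _)))
              (mul_nonneg (abs_nonneg _) (abs_nonneg _))
              (mul_nonneg (norm_nonneg _) (norm_nonneg _))
        _ = c i * c j * C i j * ‖v‖ ^ 2 := by ring
    refine h2.trans ?_
    gcongr
    linarith [le_abs_self (∑ i, ∑ j, c i * c j * C i j)]

variable [MeasurableSpace E] [BorelSpace E] [MeasurableSpace M] [BorelSpace M]

theorem isOpen_extChartAt_symm_image (x : M) {T : Set E} (hT : IsOpen T)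
    (hTt : T ⊆ (extChartAt I x).target) : IsOpen ((extChartAt I x).symm '' T) := by
  rw [PartialEquiv.symm_image_eq_source_inter_preimage _ hTt]
  exact (continuousOn_extChartAt x).isOpen_inter_preimage (isOpen_extChartAt_source x) hT

theorem extChartAt_symm_image_mem_nhds (x : M) {T : Set E} (hT : IsOpen T)
    (hTt : T ⊆ (extChartAt I x).target) (hx : extChartAt I x x ∈ T) :
    (extChartAt I x).symm '' T ∈ 𝓝 x :=
  (isOpen_extChartAt_symm_image x hT hTt).mem_nhds
    ⟨_, hx, (extChartAt I x).left_inv (mem_extChartAt_source x)⟩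

theorem IsContinuousMetric.isLocallyFiniteMeasure (hg : IsContinuousMetric g) :
    IsLocallyFiniteMeasure (riemannianVolume g) := by
  refine ⟨fun x => ?_⟩
  obtain ⟨r, hr, hrt⟩ := Metric.nhds_basis_closedBall.mem_iff.1
    (extChartAt_target_mem_nhds (I := I) x)
  obtain ⟨D, d, Λ, hD, hd, hΛ, hb⟩ := hg.exists_bounds x (isCompact_closedBall _ _) hrt
  have hbt := Metric.ball_subset_closedBall.trans hrt
  refine ⟨_, extChartAt_symm_image_mem_nhds x Metric.isOpen_ball hbt (Metric.mem_ball_self hr), ?_⟩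
  have hm := (isOpen_extChartAt_symm_image (I := I) x Metric.isOpen_ball hbt).measurableSet
  rw [← setLIntegral_one, setLIntegral_riemannianVolume (hg.continuousOn_chartDensity x) hbt hm
    measurable_const]
  calc _ ≤ ∫⁻ y in Metric.ball (extChartAt I x x) r, ENNReal.ofReal D
        ∂(finBasis ℝ E).addHaar := by
        refine setLIntegral_mono measurable_const fun y hy => ?_
        rw [one_mul]
        exact ENNReal.ofReal_le_ofReal (hb y (Metric.ball_subset_closedBall hy)).1
    _ < ⊤ := by
        rw [setLIntegral_const]
        exact ENNReal.mul_lt_top ENNReal.ofReal_lt_top measure_ball_lt_top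

end Sobolev
end

noncomputable section

section Sobolev

open scoped Topology ENNReal NNReal

variable {E : Type*} [NormedAddCommGroup E] [NormedSpace ℝ E] [FiniteDimensional ℝ E]
  {H : Type*} [TopologicalSpace H] {I : ModelWithCorners ℝ E H} [I.Boundaryless]
  {M : Type*} [TopologicalSpace M] [ChartedSpace H M] [IsManifold I ∞ M]
  {g : TwoTensor I M}
  [MeasurableSpace E] [BorelSpace E] [MeasurableSpace M] [BorelSpace M]

/-- The Gagliardo–Nirenberg–Sobolev inequality with exponents `2n/(n-2)` and `2`. -/
theorem lintegral_rpow_le_lintegral_fderiv (μ : Measure E) [μ.IsAddHaarMeasure]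
    (hn : 2 < finrank ℝ E) {v : E → ℝ} (hv : ContDiff ℝ 1 v) (hc : HasCompactSupport v) :
    (∫⁻ y, ‖v y‖ₑ ^ (2 * (finrank ℝ E : ℝ) / (finrank ℝ E - 2)) ∂μ) ^
        (((finrank ℝ E : ℝ) - 2) / finrank ℝ E) ≤
      (SNormLESNormFDerivOfEqConst ℝ μ 2 : ℝ≥0∞) ^ 2 * ∫⁻ y, ‖fderiv ℝ v y‖ₑ ^ 2 ∂μ := by
  set n : ℝ := (finrank ℝ E : ℝ) with hndef
  have hn2 : 2 < n := by rw [hndef]; exact_mod_cast hn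
  have hp0 : 0 < 2 * n / (n - 2) := div_pos (by linarith) (by linarith)
  let p' : ℝ≥0 := ⟨2 * n / (n - 2), hp0.le⟩
  have hp' : (p' : ℝ)⁻¹ = ((2 : ℝ≥0) : ℝ)⁻¹ - (finrank ℝ E : ℝ)⁻¹ := by
    rw [← hndef]
    have h1 : n - 2 ≠ 0 := by linarith
    have h2 : n ≠ 0 := by linarith
    change (2 * n / (n - 2))⁻¹ = (2 : ℝ)⁻¹ - n⁻¹
    field_simp
  have h := eLpNorm_le_eLpNorm_fderiv_of_eq (F := ℝ) μ hv hc (p := 2) (p' := p') (by norm_num)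
    (by omega) hp'
  have hpne : p' ≠ 0 := fun h0 => hp0.ne' (congrArg NNReal.toReal h0)
  rw [eLpNorm_nnreal_eq_lintegral hpne, eLpNorm_nnreal_eq_lintegral two_ne_zero] at h
  have h3 := ENNReal.rpow_le_rpow h (z := 2) (by norm_num)
  rw [ENNReal.mul_rpow_of_nonneg _ _ (by norm_num), ← ENNReal.rpow_mul, ← ENNReal.rpow_mul] at h3
  have e1 : 1 / (p' : ℝ) * 2 = (n - 2) / n := by
    change 1 / (2 * n / (n - 2)) * 2 = _
    field_simp
  have e2 : 1 / ((2 : ℝ≥0) : ℝ) * 2 = 1 := by norm_num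
  rw [e1, e2, ENNReal.rpow_one, ENNReal.rpow_two] at h3
  have e3 : (p' : ℝ) = 2 * n / (n - 2) := rfl
  rw [e3] at h3
  simpa using h3

theorem IsContinuousMetric.exists_local_sobolev (hg : IsContinuousMetric g)
    (hn : 2 < finrank ℝ E) (x : M) :
    ∃ U ∈ 𝓝 x, ∃ C : ℝ≥0, ∀ u : M → ℝ, ContMDiff I 𝓘(ℝ, ℝ) ∞ u →
      (∫⁻ z in U, ‖u z‖ₑ ^ (2 * (finrank ℝ E : ℝ) / (finrank ℝ E - 2)) ∂riemannianVolume g) ^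
        (((finrank ℝ E : ℝ) - 2) / finrank ℝ E) ≤
      C * ∫⁻ z, ENNReal.ofReal (gradNormSq g u z + u z ^ 2) ∂riemannianVolume g := by
  obtain ⟨R, hR, hRt⟩ := Metric.nhds_basis_closedBall.mem_iff.1
    (extChartAt_target_mem_nhds (I := I) x)
  obtain ⟨D, d, Λ, hD, hd, hΛ, hb⟩ := hg.exists_bounds x (isCompact_closedBall _ _) hRt
  let χ : ContDiffBump (extChartAt I x x) := ⟨R / 3, R / 2, by positivity, by linarith⟩
  obtain ⟨L, hL⟩ := (χ.hasCompactSupport.fderiv (𝕜 := ℝ)).exists_bound_of_continuous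
    ((χ.contDiff (n := 1)).continuous_fderiv one_ne_zero)
  set n : ℝ := (finrank ℝ E : ℝ) with hndef
  have hn2 : 2 < n := by rw [hndef]; exact_mod_cast hn
  set μ := (finBasis ℝ E).addHaar with hμ
  have hBt : Metric.ball (extChartAt I x x) R ⊆ (extChartAt I x).target :=
    Metric.ball_subset_closedBall.trans hRt
  have hbt : Metric.ball (extChartAt I x x) (R / 3) ⊆ (extChartAt I x).target :=
    (Metric.ball_subset_ball (by linarith)).trans hBt
  have hmb := (isOpen_extChartAt_symm_image (I := I) x Metric.isOpen_ball hbt).measurableSet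
  have hmB := (isOpen_extChartAt_symm_image (I := I) x Metric.isOpen_ball hBt).measurableSet
  set A : ℝ := 2 * Λ + 2 * L ^ 2 with hA
  have hA0 : 0 < A := by positivity
  refine ⟨_, extChartAt_symm_image_mem_nhds x Metric.isOpen_ball hbt
    (Metric.mem_ball_self (by positivity)),
    (Real.toNNReal D) ^ ((n - 2) / n) * (SNormLESNormFDerivOfEqConst ℝ μ 2) ^ 2 *
      Real.toNNReal (A / d), fun u hu => ?_⟩
  let w : E → ℝ := u ∘ (extChartAt I x).symm
  let v : E → ℝ := fun y => χ y * w y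
  have hv0 : ∀ y, y ∉ Metric.ball (extChartAt I x x) R → v =ᶠ[𝓝 y] fun _ => 0 := by
    intro y hy
    have : (Metric.closedBall (extChartAt I x x) (R / 2))ᶜ ∈ 𝓝 y :=
      Metric.isClosed_closedBall.isOpen_compl.mem_nhds fun h =>
        hy (Metric.closedBall_subset_ball (by linarith) h)
    filter_upwards [this] with z hz
    change χ z * w z = 0
    rw [χ.zero_of_le_dist (not_le.1 fun h => hz (Metric.mem_closedBall.2 h)).le, zero_mul]
  have hw : ∀ y ∈ Metric.ball (extChartAt I x x) R, ContDiffAt ℝ ∞ w y := fun y hy =>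
    contDiffAt_comp_extChartAt_symm hu (hBt hy)
  have hv : ContDiff ℝ 1 v := by
    rw [contDiff_iff_contDiffAt]
    intro y
    by_cases hy : y ∈ Metric.ball (extChartAt I x x) R
    · exact χ.contDiffAt.mul ((hw y hy).of_le (by simp))
    · exact contDiffAt_const.congr_of_eventuallyEq (hv0 y hy)
  have hc : HasCompactSupport v := χ.hasCompactSupport.mul_right
  have hmeas : Measurable fun z => ENNReal.ofReal (gradNormSq g u z + u z ^ 2) :=
    ((hg.continuous_gradNormSq hu).add (hu.continuous.pow 2)).measurable.ennreal_ofReal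
  have hleft : ∫⁻ z in (extChartAt I x).symm '' Metric.ball (extChartAt I x x) (R / 3),
      ‖u z‖ₑ ^ (2 * n / (n - 2)) ∂riemannianVolume g ≤
      ENNReal.ofReal D * ∫⁻ y, ‖v y‖ₑ ^ (2 * n / (n - 2)) ∂μ := by
    rw [setLIntegral_riemannianVolume (hg.continuousOn_chartDensity x) hbt hmb
      (hu.continuous.measurable.enorm.pow_const _), ← lintegral_const_mul' _ _ ENNReal.ofReal_ne_top]
    refine le_trans (setLIntegral_mono' Metric.isOpen_ball.measurableSet fun y hy => ?_)
      (setLIntegral_le_lintegral (Metric.ball (extChartAt I x x) (R / 3)) _)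
    have hvy : v y = u ((extChartAt I x).symm y) := by
      change χ y * _ = _
      rw [χ.one_of_mem_closedBall (Metric.ball_subset_closedBall hy), one_mul]
      rfl
    rw [hvy, mul_comm]
    gcongr
    exact (hb y (Metric.closedBall_subset_closedBall (by linarith)
      (Metric.ball_subset_closedBall hy))).1
  have hright : ∫⁻ y, ‖fderiv ℝ v y‖ₑ ^ 2 ∂μ ≤ ENNReal.ofReal (A / d) *
      ∫⁻ z, ENNReal.ofReal (gradNormSq g u z + u z ^ 2) ∂riemannianVolume g := by
    have hsupp : ∫⁻ y, ‖fderiv ℝ v y‖ₑ ^ 2 ∂μ =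
        ∫⁻ y in Metric.ball (extChartAt I x x) R, ‖fderiv ℝ v y‖ₑ ^ 2 ∂μ := by
      rw [setLIntegral_eq_of_support_subset]
      intro y hy
      by_contra h
      apply hy
      change ‖fderiv ℝ v y‖ₑ ^ 2 = 0
      have h0 : ‖fderiv ℝ v y‖ = 0 := by
        rw [(hv0 y h).fderiv_eq, fderiv_const_apply]
        exact norm_zero
      rw [← ofReal_norm, h0, ENNReal.ofReal_zero, zero_pow two_ne_zero]
    rw [hsupp]
    refine le_trans ?_ (mul_le_mul_right (setLIntegral_le_lintegral
      ((extChartAt I x).symm '' Metric.ball (extChartAt I x x) R) _) _)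
    rw [setLIntegral_riemannianVolume (hg.continuousOn_chartDensity x) hBt hmB hmeas,
      ← lintegral_const_mul' _ _ ENNReal.ofReal_ne_top]
    refine setLIntegral_mono' Metric.isOpen_ball.measurableSet fun y hy => ?_
    have hbd := hb y (Metric.ball_subset_closedBall hy)
    have hG := gradNormSq_eq_cometric hg.symm hg.pos hu (hBt hy)
    have hG0 := hg.gradNormSq_nonneg u ((extChartAt I x).symm y)
    have hΛw := norm_sq_le_cometric (finBasis ℝ E) (hg.chart_symm x y)
      (chartCoefficients_pos hg.pos (hBt hy)) hΛ.le hbd.2.2 (fderiv ℝ w y)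
    rw [← hG] at hΛw
    have hder : fderiv ℝ v y = χ y • fderiv ℝ w y + w y • fderiv ℝ χ y :=
      fderiv_mul ((χ.contDiff (n := 1)).differentiable one_ne_zero y)
        ((hw y hy).differentiableAt (by simp))
    have hno : ‖fderiv ℝ v y‖ ≤ ‖fderiv ℝ w y‖ + |w y| * L := by
      rw [hder]
      refine (norm_add_le _ _).trans (add_le_add ?_ ?_)
      · rw [norm_smul, Real.norm_eq_abs, abs_of_nonneg χ.nonneg]
        exact mul_le_of_le_one_left (norm_nonneg _) χ.le_one
      · rw [norm_smul, Real.norm_eq_abs]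
        exact mul_le_mul_of_nonneg_left (hL y) (abs_nonneg _)
    have hsq : ‖fderiv ℝ v y‖ ^ 2 ≤ A * (gradNormSq g u ((extChartAt I x).symm y) + w y ^ 2) := by
      have h1 : ‖fderiv ℝ v y‖ ^ 2 ≤ (‖fderiv ℝ w y‖ + |w y| * L) ^ 2 :=
        pow_le_pow_left₀ (norm_nonneg _) hno 2
      have h2 : (‖fderiv ℝ w y‖ + |w y| * L) ^ 2 ≤
          2 * ‖fderiv ℝ w y‖ ^ 2 + 2 * (w y ^ 2 * L ^ 2) := by
        rw [← sq_abs (w y)]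
        nlinarith [sq_nonneg (‖fderiv ℝ w y‖ - |w y| * L)]
      have h3 : 0 ≤ Λ * w y ^ 2 := by positivity
      have h4 : 0 ≤ L ^ 2 * gradNormSq g u ((extChartAt I x).symm y) := by positivity
      rw [hA]
      linarith
    have hge : 0 ≤ gradNormSq g u ((extChartAt I x).symm y) + w y ^ 2 := by positivity
    rw [← ENNReal.ofReal_mul (by exact hge), ← ENNReal.ofReal_mul (by positivity),
      ← ofReal_norm, ← ENNReal.ofReal_pow (norm_nonneg _)]
    refine ENNReal.ofReal_le_ofReal (hsq.trans ?_)
    calc A * (gradNormSq g u ((extChartAt I x).symm y) + w y ^ 2)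
        = A / d * ((gradNormSq g u ((extChartAt I x).symm y) + w y ^ 2) * d) := by
          field_simp
      _ ≤ _ := by
          exact mul_le_mul_of_nonneg_left (mul_le_mul_of_nonneg_left hbd.2.1 hge) (by positivity)
  have hsob := lintegral_rpow_le_lintegral_fderiv μ hn hv hc
  rw [← hndef] at hsob
  have hθ : 0 ≤ (n - 2) / n := div_nonneg (by linarith) (by linarith)
  calc _ ≤ (ENNReal.ofReal D * ∫⁻ y, ‖v y‖ₑ ^ (2 * n / (n - 2)) ∂μ) ^ ((n - 2) / n) :=
        ENNReal.rpow_le_rpow hleft hθ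
    _ = ENNReal.ofReal D ^ ((n - 2) / n) *
        (∫⁻ y, ‖v y‖ₑ ^ (2 * n / (n - 2)) ∂μ) ^ ((n - 2) / n) :=
        ENNReal.mul_rpow_of_nonneg _ _ hθ
    _ ≤ ENNReal.ofReal D ^ ((n - 2) / n) * ((SNormLESNormFDerivOfEqConst ℝ μ 2 : ℝ≥0∞) ^ 2 *
        (ENNReal.ofReal (A / d) *
          ∫⁻ z, ENNReal.ofReal (gradNormSq g u z + u z ^ 2) ∂riemannianVolume g)) := by
        gcongr
        exact hsob.trans (by gcongr)
    _ = _ := by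
        rw [ENNReal.coe_mul, ENNReal.coe_mul, ENNReal.coe_rpow_of_nonneg _ hθ, ENNReal.coe_pow,
          ENNReal.ofReal, ENNReal.ofReal]
        ring

theorem IsContinuousMetric.exists_sobolev [CompactSpace M] (hg : IsContinuousMetric g)
    (hn : 2 < finrank ℝ E) :
    ∃ C : ℝ≥0, ∀ u : M → ℝ, ContMDiff I 𝓘(ℝ, ℝ) ∞ u →
      (∫⁻ z, ‖u z‖ₑ ^ (2 * (finrank ℝ E : ℝ) / (finrank ℝ E - 2)) ∂riemannianVolume g) ^
        (((finrank ℝ E : ℝ) - 2) / finrank ℝ E) ≤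
      C * ∫⁻ z, ENNReal.ofReal (gradNormSq g u z + u z ^ 2) ∂riemannianVolume g := by
  choose U hU C hC using hg.exists_local_sobolev hn
  obtain ⟨t, -, ht⟩ := isCompact_univ.elim_nhds_subcover U fun x _ => hU x
  refine ⟨∑ x ∈ t, C x, fun u hu => ?_⟩
  set n : ℝ := (finrank ℝ E : ℝ) with hndef
  have hn2 : 2 < n := by rw [hndef]; exact_mod_cast hn
  have hθ : 0 < (n - 2) / n := div_pos (by linarith) (by linarith)
  have hθ1 : (n - 2) / n ≤ 1 := (div_le_one (by linarith)).2 (by linarith)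
  set f : M → ℝ≥0∞ := fun z => ‖u z‖ₑ ^ (2 * n / (n - 2))
  have h1 : ∫⁻ z, f z ∂riemannianVolume g ≤ ∑ x ∈ t, ∫⁻ z in U x, f z ∂riemannianVolume g := by
    rw [← setLIntegral_univ]
    refine (lintegral_mono_set ht).trans ?_
    have h2 := lintegral_iUnion_le (μ := riemannianVolume g) (fun x : t => U x) f
    rwa [tsum_fintype, Finset.sum_coe_sort t fun x => ∫⁻ z in U x, f z ∂riemannianVolume g,
      Set.iUnion_subtype (p := (· ∈ t)) (s := fun x => U x)] at h2
  calc _ ≤ (∑ x ∈ t, ∫⁻ z in U x, f z ∂riemannianVolume g) ^ ((n - 2) / n) :=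
        ENNReal.rpow_le_rpow h1 hθ.le
    _ ≤ ∑ x ∈ t, (∫⁻ z in U x, f z ∂riemannianVolume g) ^ ((n - 2) / n) :=
        Finset.le_sum_of_subadditive (fun a : ℝ≥0∞ => a ^ ((n - 2) / n)) (by simp [hθ])
          (fun a b => ENNReal.rpow_add_le_add_rpow a b hθ.le hθ1) _ _
    _ ≤ ∑ x ∈ t, C x * ∫⁻ z, ENNReal.ofReal (gradNormSq g u z + u z ^ 2) ∂riemannianVolume g :=
        Finset.sum_le_sum fun x _ => hC x u hu
    _ = _ := by rw [← Finset.sum_mul, ENNReal.ofNNReal_finsetSum]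

theorem IsContinuousMetric.riemannianVolume_ne_zero [Nonempty M] (hg : IsContinuousMetric g) :
    riemannianVolume g ≠ 0 := by
  obtain ⟨x⟩ := ‹Nonempty M›
  intro h0
  have hT := isOpen_extChartAt_target (I := I) x
  have h1 := setLIntegral_riemannianVolume (hg.continuousOn_chartDensity x) subset_rfl
    (isOpen_extChartAt_symm_image (I := I) x hT subset_rfl).measurableSet
    (measurable_const (a := (1 : ℝ≥0∞)))
  rw [h0] at h1
  simp only [Measure.restrict_zero, lintegral_zero_measure, one_mul] at h1
  have h2 := (lintegral_eq_zero_iff'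
    (aemeasurable_chartDensity (hg.continuousOn_chartDensity x))).1 h1.symm
  rw [Filter.EventuallyEq, ae_restrict_iff' hT.measurableSet] at h2
  have h3 : (finBasis ℝ E).addHaar (extChartAt I x).target = 0 := by
    rw [measure_eq_zero_iff_ae_notMem]
    filter_upwards [h2] with y hy hyt
    have := hy hyt
    rw [Pi.zero_apply, ENNReal.ofReal_eq_zero] at this
    exact absurd (hg.chartDensity_pos hyt) (not_lt.2 this)
  exact (hT.measure_pos _ ⟨_, mem_extChartAt_target x⟩).ne' h3

/-- A closed manifold of dimension at least three with a metric of constant positive scalar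
curvature has positive Yamabe constant. -/
theorem IsContinuousMetric.yamabeConstant_pos [CompactSpace M] [Nonempty M]
    (hg : IsContinuousMetric g) (hn : 2 < finrank ℝ E) {R : ℝ} (hR : 0 < R)
    (hscal : ∀ x, scalarCurvature g x = R) : 0 < yamabeConstant g := by
  obtain ⟨C, hC⟩ := hg.exists_sobolev hn
  set V := riemannianVolume g with hV
  have := hg.isLocallyFiniteMeasure
  have : IsFiniteMeasure V := ⟨isCompact_univ.measure_lt_top⟩
  have hV0 : V ≠ 0 := hg.riemannianVolume_ne_zero
  have : NeZero V := ⟨hV0⟩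
  set n : ℝ := (finrank ℝ E : ℝ) with hndef
  have hn2 : 2 < n := by rw [hndef]; exact_mod_cast hn
  set a : ℝ := 4 * (n - 1) / (n - 2) with ha
  have ha0 : 0 < a := div_pos (by linarith) (by linarith)
  set c : ℝ := min a R with hc
  have hc0 : 0 < c := lt_min ha0 hR
  have hinteg : ∀ f : M → ℝ, Continuous f → Integrable f V := fun f hf =>
    hf.integrable_of_hasCompactSupport (HasCompactSupport.of_compactSpace f)
  have : Nonempty {u : M → ℝ // ContMDiff I 𝓘(ℝ, ℝ) ∞ u ∧ ∀ x, 0 < u x} :=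
    ⟨⟨fun _ => 1, contMDiff_const, fun _ => one_pos⟩⟩
  refine lt_of_lt_of_le (b := c / (C + 1)) (by positivity) (le_ciInf fun ⟨u, hu, hpos⟩ => ?_)
  have hgc := hg.continuous_gradNormSq hu
  have hg0 := hg.gradNormSq_nonneg u
  simp only [yamabeQuotient, hscal, ← hndef, ← ha, ← hV]
  have hpc : Continuous fun z => u z ^ (2 * n / (n - 2)) :=
    hu.continuous.rpow_const fun z => Or.inl (hpos z).ne'
  have hX0 : 0 < ∫ z, u z ^ (2 * n / (n - 2)) ∂V := by
    rw [integral_pos_iff_support_of_nonneg (fun z => Real.rpow_nonneg (hpos z).le _) (hinteg _ hpc)]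
    have : Function.support (fun z => u z ^ (2 * n / (n - 2))) = Set.univ :=
      Set.eq_univ_of_forall fun z => (Real.rpow_pos_of_pos (hpos z) _).ne'
    rw [this]
    exact Measure.measure_univ_pos.2 hV0
  set X := ∫ z, u z ^ (2 * n / (n - 2)) ∂V with hX
  set Q := ∫ z, (gradNormSq g u z + u z ^ 2) ∂V with hQ
  have hQ0 : 0 ≤ Q := integral_nonneg fun z => add_nonneg (hg0 z) (sq_nonneg _)
  have hsob : X ^ ((n - 2) / n) ≤ C * Q := by
    have h1 := hC u hu
    have h2 : ∫⁻ z, ‖u z‖ₑ ^ (2 * n / (n - 2)) ∂V = ENNReal.ofReal X := by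
      rw [hX, ofReal_integral_eq_lintegral_ofReal (hinteg _ hpc)
        (Filter.Eventually.of_forall fun z => Real.rpow_nonneg (hpos z).le _)]
      refine lintegral_congr fun z => ?_
      rw [← ofReal_norm, Real.norm_eq_abs, abs_of_pos (hpos z),
        ENNReal.ofReal_rpow_of_pos (hpos z)]
    have h3 : ∫⁻ z, ENNReal.ofReal (gradNormSq g u z + u z ^ 2) ∂V = ENNReal.ofReal Q := by
      rw [hQ, ofReal_integral_eq_lintegral_ofReal (hinteg (fun z => gradNormSq g u z + u z ^ 2)
        (hgc.add (hu.continuous.pow 2))) (Filter.Eventually.of_forall fun z => add_nonneg (hg0 z) (sq_nonneg _))]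
    rw [h2, h3, ENNReal.ofReal_rpow_of_pos hX0, ← ENNReal.ofReal_coe_nnreal,
      ← ENNReal.ofReal_mul C.coe_nonneg] at h1
    exact (ENNReal.ofReal_le_ofReal_iff (mul_nonneg C.coe_nonneg hQ0)).1 h1
  have hden : 0 < X ^ ((n - 2) / n) := Real.rpow_pos_of_pos hX0 _
  rw [div_le_div_iff₀ (by positivity) hden]
  have hnum : c * Q ≤ ∫ z, (a * gradNormSq g u z + R * u z ^ 2) ∂V := by
    rw [hQ, ← integral_const_mul]
    refine integral_mono (hinteg _ (continuous_const.mul (hgc.add (hu.continuous.pow 2))))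
      (hinteg _ ((continuous_const.mul hgc).add (continuous_const.mul (hu.continuous.pow 2))))
      fun z => ?_
    change c * (gradNormSq g u z + u z ^ 2) ≤ a * gradNormSq g u z + R * u z ^ 2
    rw [mul_add]
    exact add_le_add (mul_le_mul_of_nonneg_right (min_le_left _ _) (hg0 z))
      (mul_le_mul_of_nonneg_right (min_le_right _ _) (sq_nonneg _))
  calc c * X ^ ((n - 2) / n) ≤ c * (C * Q) := by gcongr
    _ ≤ c * ((C + 1) * Q) := by gcongr; linarith
    _ = (c * Q) * (C + 1) := by ring
    _ ≤ _ := by gcongr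

end Sobolev
end

noncomputable section

/-! ### The sphere is simply connected -/

section SphereSimplyConnected

open scoped unitInterval
open Metric

variable {E : Type*} [NormedAddCommGroup E] [InnerProductSpace ℝ E]

/-- Radial projection to the unit sphere. -/
def sphereProj (x : E) (hx : x ≠ 0) : sphere (0 : E) 1 :=
  ⟨‖x‖⁻¹ • x, by simp [norm_smul, hx]⟩

theorem sphereProj_eq_self (x : sphere (0 : E) 1) (hx : (x : E) ≠ 0) : sphereProj (x : E) hx = x :=
  Subtype.ext (by simp [sphereProj])

theorem continuous_sphereProj {X : Type*} [TopologicalSpace X] {f : X → E} (hf : Continuous f)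
    (h0 : ∀ x, f x ≠ 0) : Continuous fun x => sphereProj (f x) (h0 x) :=
  ((hf.norm.inv₀ fun x => norm_ne_zero_iff.2 (h0 x)).smul hf).subtype_mk _

theorem interpolation_ne_zero {a b : E} (ha : ‖a‖ = 1) (hab : ‖b - a‖ < 1) (s : I) :
    a + (s : ℝ) • (b - a) ≠ 0 := by
  intro h
  have h1 : ‖(s : ℝ) • (b - a)‖ = 1 := by rw [← ha, ← norm_neg a, eq_neg_of_add_eq_zero_right h]
  rw [norm_smul, Real.norm_of_nonneg s.2.1] at h1
  nlinarith [s.2.2, norm_nonneg (b - a)]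

/-- A loop in the sphere is homotopic to the normalization of any loop close to it. -/
theorem exists_homotopic_sphereProj {x : sphere (0 : E) 1} (γ : Path x x) {f : I → E}
    (hf : Continuous f) (h0 : f 0 = x) (h1 : f 1 = x) (hfγ : ∀ t, ‖f t - γ t‖ < 1) :
    ∃ δ : Path x x, γ.Homotopic δ ∧ ∀ t, ∃ r : ℝ, 0 < r ∧ (δ t : E) = r • f t := by
  have hγ : ∀ t, ‖(γ t : E)‖ = 1 := fun t => by simp
  have hne := fun (s t : I) => interpolation_ne_zero (hγ t) (hfγ t) s
  have hfne : ∀ t, f t ≠ 0 := fun t => by simpa using hne 1 t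
  have hx : (x : E) ≠ 0 := ne_zero_of_mem_unit_sphere x
  let δ : Path x x :=
    { toFun := fun t => sphereProj (f t) (hfne t)
      continuous_toFun := continuous_sphereProj hf hfne
      source' := by simp only [h0, sphereProj_eq_self]
      target' := by simp only [h1, sphereProj_eq_self] }
  refine ⟨δ, ⟨⟨⟨⟨fun p => sphereProj _ (hne p.1 p.2), continuous_sphereProj ?_ _⟩, ?_, ?_⟩, ?_⟩⟩, ?_⟩
  · fun_prop
  · intro t
    simp [sphereProj_eq_self]
  · intro t
    simp [δ]
  · rintro s t (rfl | rfl)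
    · simp [h0, sphereProj_eq_self]
    · simp [h1, sphereProj_eq_self]
  · exact fun t => ⟨‖f t‖⁻¹, by simpa using hfne t, rfl⟩

theorem contractibleSpace_sphere_compl_singleton (v : sphere (0 : E) 1) :
    ContractibleSpace ({v}ᶜ : Set (sphere (0 : E) 1)) := by
  have hv : ‖(v : E)‖ = 1 := by simp
  let e := stereographic hv
  have hs : e.source = {v}ᶜ := stereographic_source hv
  have ht : e.target = Set.univ := stereographic_target hv
  rw [← hs]
  have h1 : ContractibleSpace (Set.univ : Set (ℝ ∙ (v : E))ᗮ) :=
    (Homeomorph.Set.univ _).contractibleSpace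
  rw [← ht] at h1
  exact e.toHomeomorphSourceTarget.contractibleSpace

/-- The unit sphere of a space of dimension at least three is simply connected. -/
theorem simplyConnectedSpace_sphere [FiniteDimensional ℝ E] (hE : 2 < finrank ℝ E) :
    SimplyConnectedSpace (sphere (0 : E) 1) := by
  rw [simply_connected_iff_loops_nullhomotopic]
  refine ⟨isPathConnected_iff_pathConnectedSpace.1 (isPathConnected_sphere ?_ 0 zero_le_one), ?_⟩
  · rw [← finrank_eq_rank]
    exact_mod_cast (by omega : 1 < finrank ℝ E)
  intro x γ
  have hγc : Continuous fun t : ℝ => (γ.extend t : E) :=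
    continuous_subtype_val.comp γ.continuous_extend
  obtain ⟨G, hG, hGγ, -⟩ := hγc.exists_contDiff_approx 1 (ε := fun _ => 1 / 4) continuous_const
    (fun _ => by norm_num)
  let q : ℝ → E := fun t => G t - (1 - t) • (G 0 - x) - t • (G 1 - x)
  have hq : ContDiff ℝ 1 q := by fun_prop
  have hb0 : ‖G 0 - x‖ < 1 / 4 := by simpa [dist_eq_norm] using hGγ 0
  have hb1 : ‖G 1 - x‖ < 1 / 4 := by simpa [dist_eq_norm] using hGγ 1
  have hqγ : ∀ t : I, ‖q t - γ t‖ < 1 := by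
    intro t
    have h1 : ‖G t - γ t‖ < 1 / 4 := by simpa [dist_eq_norm] using hGγ t
    have e1 : q t - γ t = (G t - γ t) - (1 - (t : ℝ)) • (G 0 - x) - (t : ℝ) • (G 1 - x) := by
      simp only [q]; abel
    rw [e1]
    have h2 : ‖(1 - (t : ℝ)) • (G 0 - x)‖ ≤ 1 / 4 := by
      rw [norm_smul, Real.norm_of_nonneg (by linarith [t.2.2])]
      nlinarith [t.2.1, t.2.2, norm_nonneg (G 0 - x)]
    have h3 : ‖(t : ℝ) • (G 1 - x)‖ ≤ 1 / 4 := by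
      rw [norm_smul, Real.norm_of_nonneg t.2.1]
      nlinarith [t.2.1, t.2.2, norm_nonneg (G 1 - x)]
    linarith [norm_sub_le (G t - γ t - (1 - (t : ℝ)) • (G 0 - x)) ((t : ℝ) • (G 1 - x)),
      norm_sub_le (G t - γ t) ((1 - (t : ℝ)) • (G 0 - x))]
  obtain ⟨δ, hδ, hδq⟩ := exists_homotopic_sphereProj γ (f := fun t => q t)
    (hq.continuous.comp continuous_subtype_val) (by simp [q]) (by simp [q]) hqγ
  refine hδ.trans ?_
  have hcone : ContDiff ℝ 1 fun p : ℝ × ℝ => p.1 • q p.2 := by fun_prop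
  obtain ⟨v, hv⟩ := (hcone.dense_compl_range_of_finrank_lt_finrank (by simpa using hE)).nonempty
  have hv0 : v ≠ 0 := by
    rintro rfl
    exact hv ⟨(0, 0), by simp⟩
  have hδv : ∀ t, δ t ∈ ({sphereProj v hv0}ᶜ : Set (sphere (0 : E) 1)) := by
    intro t ht
    obtain ⟨r, hr, hrt⟩ := hδq t
    rw [Set.mem_singleton_iff.1 ht] at hrt
    refine hv ⟨(‖v‖ * r, t), ?_⟩
    simp only [mul_smul, ← hrt]
    simp [sphereProj, smul_smul, hv0]
  have := contractibleSpace_sphere_compl_singleton (sphereProj v hv0)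
  have hs : IsSimplyConnected ({sphereProj v hv0}ᶜ : Set (sphere (0 : E) 1)) :=
    SimplyConnectedSpace.ofContractible _
  obtain ⟨F, -⟩ := (isSimplyConnected_iff_exists_homotopy_refl_forall_mem.1 hs).2 x δ hδv
  exact ⟨F⟩

end SphereSimplyConnected
end

noncomputable section

/-! ### The sphere is not contractible -/

section NoRetraction

open Metric
open scoped Topology NNReal ENNReal

section Det

variable {E : Type*} [NormedAddCommGroup E] [NormedSpace ℝ E] [FiniteDimensional ℝ E]

theorem exists_polynomial_det_one_add_smul (A : E →L[ℝ] E) :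
    ∃ Q : Polynomial ℝ, Q.natDegree ≤ finrank ℝ E ∧ ∀ t : ℝ, Q.eval t = (1 + t • A).det := by
  set b := finBasis ℝ E
  set B := LinearMap.toMatrix b b A.toLinearMap
  refine ⟨((Polynomial.X : Polynomial ℝ) • B.map Polynomial.C +
    (1 : Matrix _ _ ℝ).map Polynomial.C).det, ?_, fun t => ?_⟩
  · simpa using Polynomial.natDegree_det_X_add_C_le B 1
  · have h1 : (1 + t • A).det = LinearMap.det (1 + t • A.toLinearMap) := rfl
    rw [h1, ← LinearMap.det_toMatrix b, ← Polynomial.coe_evalRingHom, RingHom.map_det]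
    congr 1
    have h2 : LinearMap.toMatrix b b (1 + t • A.toLinearMap) = t • B + 1 := by
      rw [map_add, map_smul, LinearMap.toMatrix_one, add_comm]
    rw [h2]
    ext i j
    rcases eq_or_ne i j with rfl | hij
    · simp; ring
    · simp [Matrix.one_apply_ne hij]; ring

/-- `det (1 + A)` as an affine combination of the values `det (1 + t A)` at given nodes. -/
theorem det_one_add_eq_sum_basis {s : Finset ℕ} {τ : ℕ → ℝ} (hτ : Set.InjOn τ s)
    (hs : finrank ℝ E < s.card) (A : E →L[ℝ] E) :
    (1 + A).det = ∑ i ∈ s, (1 + τ i • A).det * (Lagrange.basis s τ i).eval 1 := by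
  obtain ⟨Q, hQd, hQ⟩ := exists_polynomial_det_one_add_smul A
  have h1 : Q.degree < s.card := lt_of_le_of_lt Polynomial.degree_le_natDegree
    (by exact_mod_cast lt_of_le_of_lt hQd hs)
  have h2 := congrArg (Polynomial.eval 1) (Lagrange.eq_interpolate hτ h1)
  rw [hQ, one_smul, Lagrange.interpolate_apply, Polynomial.eval_finsetSum] at h2
  rw [h2]
  exact Finset.sum_congr rfl fun i _ => by rw [Polynomial.eval_mul, Polynomial.eval_C, hQ]

theorem det_one_add_pos {A : E →L[ℝ] E} (hA : ‖A‖ < 1) : 0 < (1 + A).det := by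
  have hc : Continuous fun s : ℝ => (1 + s • A).det :=
    ContinuousLinearMap.continuous_det.comp
      (continuous_const.add (continuous_id.smul continuous_const))
  have hne : ∀ s ∈ Set.Icc (0 : ℝ) 1, (1 + s • A).det ≠ 0 := by
    intro s hs h0
    have h1 := LinearMap.bot_lt_ker_of_det_eq_zero (f := (1 + s • A).toLinearMap) h0
    obtain ⟨v, hv, hv0⟩ := (Submodule.ne_bot_iff _).1 h1.ne'
    have h2 : v + s • A v = 0 := hv
    have h3 : ‖v‖ = s * ‖A v‖ :=
      calc ‖v‖ = ‖-(s • A v)‖ := congrArg norm (eq_neg_of_add_eq_zero_left h2)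
        _ = s * ‖A v‖ := by rw [norm_neg, norm_smul, Real.norm_of_nonneg hs.1]
    have h4 := A.le_opNorm v
    have h5 : 0 < ‖v‖ := norm_pos_iff.2 hv0
    nlinarith [hs.1, hs.2, norm_nonneg (A v), norm_nonneg A]
  by_contra h
  have h01 : (0 : ℝ) ∈ Set.Icc (1 + (1 : ℝ) • A).det (1 + (0 : ℝ) • A).det := by
    refine ⟨by simpa using not_lt.1 h, ?_⟩
    rw [zero_smul, add_zero]
    have : (1 : E →L[ℝ] E).det = 1 := LinearMap.det_id
    rw [this]
    exact zero_le_one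
  obtain ⟨s, hs, hs0⟩ := intermediate_value_Icc' zero_le_one hc.continuousOn h01
  exact hne s hs hs0

end Det

variable {E : Type*} [NormedAddCommGroup E] [NormedSpace ℝ E]

theorem exists_norm_eq_one_between {x y : E} (hx : ‖x‖ ≤ 1) (hy : 1 ≤ ‖y‖) :
    ∃ z, ‖z‖ = 1 ∧ dist x z ≤ dist x y := by
  have hc : ContinuousOn (fun s : ℝ => ‖x + s • (y - x)‖) (Set.Icc 0 1) := by fun_prop
  obtain ⟨s, hs, hs1⟩ := intermediate_value_Icc zero_le_one hc
    (show (1 : ℝ) ∈ _ by simpa using ⟨hx, hy⟩)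
  refine ⟨_, hs1, ?_⟩
  rw [dist_self_add_right, norm_smul, Real.norm_of_nonneg hs.1, dist_comm, dist_eq_norm]
  exact mul_le_of_le_one_left (norm_nonneg _) hs.2

theorem lipschitzWith_indicator_ball {h : E → E} {K : ℝ≥0}
    (hK : LipschitzOnWith K h (closedBall 0 1)) (h0 : ∀ x, ‖x‖ = 1 → h x = 0) :
    LipschitzWith K ((ball 0 1).indicator h) := by
  have hin : ∀ x, ‖x‖ ≤ 1 → (ball (0 : E) 1).indicator h x = h x := by
    intro x hx
    by_cases hx1 : x ∈ ball (0 : E) 1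
    · exact Set.indicator_of_mem hx1 h
    · rw [Set.indicator_of_notMem hx1, h0 x (le_antisymm hx (by simpa using hx1))]
  have hout : ∀ x, 1 ≤ ‖x‖ → (ball (0 : E) 1).indicator h x = 0 := by
    intro x hx
    exact Set.indicator_of_notMem (by simpa using hx) h
  have hmix : ∀ x y, ‖x‖ ≤ 1 → 1 ≤ ‖y‖ → dist ((ball (0 : E) 1).indicator h x)
      ((ball (0 : E) 1).indicator h y) ≤ K * dist x y := by
    intro x y hx hy
    obtain ⟨z, hz, hxz⟩ := exists_norm_eq_one_between hx hy
    rw [hin x hx, hout y hy, ← h0 z hz]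
    exact (hK.dist_le_mul x (by simpa using hx) z (by simpa using hz.le)).trans (by gcongr)
  refine LipschitzWith.of_dist_le_mul fun x y => ?_
  rcases le_total ‖x‖ 1 with hx | hx <;> rcases le_total ‖y‖ 1 with hy | hy
  · rw [hin x hx, hin y hy]
    exact hK.dist_le_mul x (by simpa using hx) y (by simpa using hy)
  · exact hmix x y hx hy
  · rw [dist_comm, dist_comm x]
    exact hmix y x hy hx
  · rw [hout x hx, hout y hy, dist_self]
    positivity

theorem bijective_id_add_of_lipschitzWith [CompleteSpace E] {h : E → E} {K : ℝ≥0}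
    (hK : LipschitzWith K h) (hK1 : K < 1) : Function.Bijective fun x => x + h x := by
  have ha : ApproximatesLinearOn (fun x => x + h x)
      ((ContinuousLinearEquiv.refl ℝ E : E ≃L[ℝ] E) : E →L[ℝ] E) Set.univ K := by
    rw [ApproximatesLinearOn.approximatesLinearOn_iff_lipschitzOnWith]
    have : (fun x => x + h x) - ⇑((ContinuousLinearEquiv.refl ℝ E : E ≃L[ℝ] E) : E →L[ℝ] E) = h := by
      ext x
      simp
    rw [this]
    exact hK.lipschitzOnWith
  have hc : Subsingleton E ∨
      K < ‖((ContinuousLinearEquiv.refl ℝ E).symm : E →L[ℝ] E)‖₊⁻¹ := by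
    rcases subsingleton_or_nontrivial E with hE | hE
    · exact Or.inl hE
    · refine Or.inr ?_
      have : ‖((ContinuousLinearEquiv.refl ℝ E).symm : E →L[ℝ] E)‖₊ = 1 :=
        NNReal.eq ContinuousLinearMap.norm_id
      rw [this, inv_one]
      exact hK1
  exact ⟨Set.injOn_univ.1 (ha.injOn hc), ha.surjective hc⟩

theorem image_ball_of_bijective {f : E → E} (hf : Function.Bijective f)
    (hid : ∀ x ∉ ball (0 : E) 1, f x = x) : f '' ball 0 1 = ball 0 1 := by
  ext y
  constructor
  · rintro ⟨x, hx, rfl⟩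
    by_contra hy
    rw [hf.1 (hid _ hy)] at hy
    exact hy hx
  · intro hy
    obtain ⟨x, rfl⟩ := hf.2 y
    refine ⟨x, ?_, rfl⟩
    by_contra hx
    rw [hid x hx] at hy
    exact hx hy

theorem setIntegral_det_one_add_eq [FiniteDimensional ℝ E] [MeasurableSpace E] [BorelSpace E]
    (μ : Measure E) [μ.IsAddHaarMeasure] {h : E → E} (hh : ContDiff ℝ 1 h)
    (h0 : ∀ x, ‖x‖ = 1 → h x = 0) :
    ∫ x in ball (0 : E) 1, (1 + fderiv ℝ h x).det ∂μ = μ.real (ball 0 1) := by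
  obtain ⟨C, hC⟩ := (isCompact_closedBall (0 : E) 1).exists_bound_of_continuousOn
    (hh.continuous_fderiv one_ne_zero).continuousOn
  set K : ℝ≥0 := Real.toNNReal C + 1 with hKdef
  have hCK : ∀ x ∈ closedBall (0 : E) 1, ‖fderiv ℝ h x‖ ≤ K := fun x hx =>
    (hC x hx).trans ((Real.le_coe_toNNReal C).trans (by simp [hKdef]))
  have hK0 : 0 < K := by positivity
  have hLip : LipschitzOnWith K h (closedBall 0 1) :=
    (convex_closedBall (0 : E) 1).lipschitzOnWith_of_nnnorm_fderiv_le
      (fun x _ => hh.differentiable one_ne_zero x) fun x hx => hCK x hx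
  have hsmall : ∀ t : ℝ≥0, t * K < 1 →
      ∫ x in ball (0 : E) 1, (1 + (t : ℝ) • fderiv ℝ h x).det ∂μ = μ.real (ball 0 1) := by
    intro t ht
    have hLt : LipschitzOnWith (t * K) (fun x => (t : ℝ) • h x) (closedBall 0 1) := by
      refine LipschitzOnWith.of_dist_le_mul fun x hx y hy => ?_
      rw [dist_smul₀, Real.norm_of_nonneg t.coe_nonneg, NNReal.coe_mul, mul_assoc]
      exact mul_le_mul_of_nonneg_left (hLip.dist_le_mul x hx y hy) t.coe_nonneg
    have hbij := bijective_id_add_of_lipschitzWith (lipschitzWith_indicator_ball hLt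
      fun x hx => by rw [h0 x hx, smul_zero]) ht
    have him := image_ball_of_bijective hbij fun x hx => by
      simp [Set.indicator_of_notMem hx]
    have hder : ∀ x ∈ ball (0 : E) 1, HasFDerivWithinAt
        (fun x => x + (ball (0 : E) 1).indicator (fun x => (t : ℝ) • h x) x)
        (1 + (t : ℝ) • fderiv ℝ h x) (ball 0 1) x := by
      intro x hx
      have h1 : HasFDerivWithinAt (fun x => x + (t : ℝ) • h x)
          (1 + (t : ℝ) • fderiv ℝ h x) (ball 0 1) x :=
        ((hasFDerivAt_id x).add
          ((hh.differentiable one_ne_zero x).hasFDerivAt.const_smul (t : ℝ))).hasFDerivWithinAt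
      refine h1.congr (fun y hy => ?_) ?_
      · rw [Set.indicator_of_mem hy]
      · rw [Set.indicator_of_mem hx]
    have hcv := lintegral_abs_det_fderiv_eq_addHaar_image μ measurableSet_ball hder hbij.1.injOn
    rw [him] at hcv
    have hpos : ∀ x ∈ ball (0 : E) 1, 0 < (1 + (t : ℝ) • fderiv ℝ h x).det := by
      intro x hx
      refine det_one_add_pos ?_
      rw [norm_smul, Real.norm_of_nonneg t.coe_nonneg]
      exact lt_of_le_of_lt (mul_le_mul_of_nonneg_left (hCK x (ball_subset_closedBall hx))
        t.coe_nonneg) (by exact_mod_cast ht)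
    have hcont : Continuous fun x => (1 + (t : ℝ) • fderiv ℝ h x).det :=
      ContinuousLinearMap.continuous_det.comp (continuous_const.add
        ((hh.continuous_fderiv one_ne_zero).const_smul (t : ℝ)))
    rw [integral_eq_lintegral_of_nonneg_ae
      ((ae_restrict_mem measurableSet_ball).mono fun x hx => (hpos x hx).le)
      hcont.aestronglyMeasurable, Measure.real, ← hcv]
    congr 1
    exact setLIntegral_congr_fun measurableSet_ball fun x hx => by rw [abs_of_pos (hpos x hx)]
  let τ : ℕ → ℝ≥0 := fun i => (K * (i + 2))⁻¹
  have hτinj : Function.Injective fun i => (τ i : ℝ) := by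
    intro i j hij
    have h1 : τ i = τ j := NNReal.eq hij
    have h2 : K * ((i : ℝ≥0) + 2) = K * (j + 2) := inv_injective h1
    have h3 := mul_left_cancel₀ hK0.ne' h2
    exact_mod_cast add_right_cancel h3
  have hτK : ∀ i, τ i * K < 1 := by
    intro i
    change (K * ((i : ℝ≥0) + 2))⁻¹ * K < 1
    rw [mul_inv, mul_comm, ← mul_assoc, mul_inv_cancel₀ hK0.ne', one_mul]
    refine inv_lt_one_of_one_lt₀ ?_
    exact lt_of_lt_of_le one_lt_two (by simp)
  set s := Finset.range (finrank ℝ E + 1) with hs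
  have hinteg : ∀ i, IntegrableOn (fun x => (1 + (τ i : ℝ) • fderiv ℝ h x).det) (ball 0 1) μ := by
    intro i
    have hcont : Continuous fun x => (1 + (τ i : ℝ) • fderiv ℝ h x).det :=
      ContinuousLinearMap.continuous_det.comp (continuous_const.add
        ((hh.continuous_fderiv one_ne_zero).const_smul (τ i : ℝ)))
    exact (hcont.continuousOn.integrableOn_compact (isCompact_closedBall 0 1)).mono_set
      ball_subset_closedBall
  calc ∫ x in ball (0 : E) 1, (1 + fderiv ℝ h x).det ∂μ
      = ∫ x in ball (0 : E) 1, ∑ i ∈ s, (1 + (τ i : ℝ) • fderiv ℝ h x).det *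
          (Lagrange.basis s (fun i => (τ i : ℝ)) i).eval 1 ∂μ :=
        integral_congr_ae (Filter.Eventually.of_forall fun x =>
          det_one_add_eq_sum_basis hτinj.injOn (by simp [hs]) _)
    _ = ∑ i ∈ s, μ.real (ball 0 1) * (Lagrange.basis s (fun i => (τ i : ℝ)) i).eval 1 := by
        rw [integral_finsetSum _ fun i _ => (hinteg i).mul_const _]
        exact Finset.sum_congr rfl fun i _ => by rw [integral_mul_const, hsmall _ (hτK i)]
    _ = μ.real (ball 0 1) := by
        rw [← Finset.mul_sum, ← Polynomial.eval_finsetSum,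
          Lagrange.sum_basis hτinj.injOn (by simp [hs]), Polynomial.eval_one, mul_one]

end NoRetraction

section NotContractible

open Metric
open scoped Topology unitInterval

variable {E : Type*} [NormedAddCommGroup E] [InnerProductSpace ℝ E] [FiniteDimensional ℝ E]

theorem det_fderiv_eq_zero_of_norm_eq_one {r : E → E} (hr : Differentiable ℝ r)
    (h1 : ∀ x, ‖r x‖ = 1) (x : E) : (fderiv ℝ r x).det = 0 := by
  by_contra hdet
  have hsurj : Function.Surjective (fderiv ℝ r x) :=
    (LinearMap.equivOfDetNeZero (fderiv ℝ r x).toLinearMap hdet).surjective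
  obtain ⟨v, hv⟩ := hsurj (r x)
  have hd := ((hr x).hasFDerivAt.inner ℝ (hr x).hasFDerivAt)
  have hc : (fun y => inner ℝ (r y) (r y)) = fun _ => (1 : ℝ) := by
    ext y
    rw [real_inner_self_eq_norm_sq, h1, one_pow]
  rw [hc] at hd
  have h2 := DFunLike.congr_fun (hd.unique (hasFDerivAt_const (1 : ℝ) x)) v
  simp [hv, h1] at h2

/-- There is no differentiable retraction of the ball onto the sphere. -/
theorem not_exists_retraction {r : E → E} (hr : ContDiff ℝ 1 r) (h1 : ∀ x, ‖r x‖ = 1)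
    (hid : ∀ x, ‖x‖ = 1 → r x = x) : False := by
  borelize E
  have h := setIntegral_det_one_add_eq (Measure.addHaar : Measure E) (h := fun x => r x - x)
    (hr.sub contDiff_id) fun x hx => by rw [hid x hx, sub_self]
  have h2 : ∀ x, (1 + fderiv ℝ (fun x => r x - x) x).det = 0 := by
    intro x
    rw [fderiv_fun_sub (hr.differentiable one_ne_zero x) differentiableAt_fun_id, fderiv_fun_id]
    rw [← det_fderiv_eq_zero_of_norm_eq_one (hr.differentiable one_ne_zero) h1 x]
    congr 1
    exact add_sub_cancel _ _
  simp only [h2, integral_zero] at h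
  exact (ENNReal.toReal_pos (measure_ball_pos _ (0 : E) one_pos).ne'
    measure_ball_lt_top.ne).ne h

theorem not_contractibleSpace_sphere : ¬ ContractibleSpace (sphere (0 : E) 1) := by
  intro hcon
  obtain ⟨y, ⟨H⟩⟩ := id_nullhomotopic (sphere (0 : E) 1)
  classical
  let u : E → sphere (0 : E) 1 := fun x => if hx : x = 0 then y else sphereProj x hx
  let ρ : E → I := fun x => Set.projIcc 0 1 zero_le_one (3 - 4 * ‖x‖)
  let F : E → E := fun x => H (ρ x, u x)
  have hF1 : ∀ x, ‖F x‖ = 1 := fun x => by simp [F]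
  have hFin : ∀ x, ‖x‖ ≤ 1 / 2 → F x = y := by
    intro x hx
    have : ρ x = 1 := Set.projIcc_of_right_le _ (by linarith)
    simp [F, this]
  have hFout : ∀ x, 3 / 4 ≤ ‖x‖ → F x = ‖x‖⁻¹ • x := by
    intro x hx
    have h0 : ρ x = 0 := Set.projIcc_of_le_left _ (by linarith)
    have hx0 : x ≠ 0 := norm_pos_iff.1 (by linarith)
    simp [F, h0, u, hx0, sphereProj]
  have hFc : Continuous F := by
    rw [continuous_iff_continuousAt]
    intro x
    rcases eq_or_ne x 0 with rfl | hx
    · refine (continuousAt_const (y := (y : E))).congr ?_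
      filter_upwards [ball_mem_nhds (0 : E) (by norm_num : (0 : ℝ) < 1 / 2)] with z hz
      exact (hFin z (by simpa using (mem_ball_zero_iff.1 hz).le)).symm
    · have hu : ContinuousAt u x := by
        rw [Topology.IsInducing.subtypeVal.continuousAt_iff]
        have : ContinuousAt (fun z : E => ‖z‖⁻¹ • z) x :=
          (continuousAt_id.norm.inv₀ (norm_ne_zero_iff.2 hx)).smul continuousAt_id
        refine this.congr ?_
        filter_upwards [isOpen_ne.mem_nhds hx] with z hz
        simp [u, dif_neg hz, sphereProj]
      have hρ : Continuous ρ := continuous_projIcc.comp (by fun_prop)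
      exact continuous_subtype_val.continuousAt.comp
        (H.continuous.continuousAt.comp (hρ.continuousAt.prodMk hu))
  have hU : {x : E | 3 / 4 < ‖x‖} ∈ 𝓝ˢ (sphere (0 : E) 1) :=
    (isOpen_lt continuous_const continuous_norm).mem_nhdsSet.2 fun x hx => by
      have : ‖x‖ = 1 := by simpa using hx
      change 3 / 4 < ‖x‖
      linarith
  have hFU : ContDiffOn ℝ 1 F {x : E | 3 / 4 < ‖x‖} := by
    intro x hx
    have hx' : 3 / 4 < ‖x‖ := hx
    have hx0 : x ≠ 0 := norm_pos_iff.1 (by linarith)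
    have : ContDiffAt ℝ 1 (fun z : E => ‖z‖⁻¹ • z) x :=
      ((contDiffAt_norm ℝ hx0).inv (norm_ne_zero_iff.2 hx0)).smul contDiffAt_id
    exact this.contDiffWithinAt.congr (fun z hz => hFout z (le_of_lt hz)) (hFout x hx'.le)
  obtain ⟨G, hG, hGF, hGS, -⟩ := hFc.exists_contDiff_approx_and_eqOn 1 (ε := fun _ => 1 / 2)
    continuous_const (fun _ => by norm_num) isClosed_sphere hU hFU
  have hG0 : ∀ x, G x ≠ 0 := by
    intro x h0
    have := hGF x
    rw [h0, dist_zero_left, hF1] at this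
    norm_num at this
  refine not_exists_retraction (r := fun x => ‖G x‖⁻¹ • G x)
    ((((hG.norm ℝ hG0)).inv fun x => norm_ne_zero_iff.2 (hG0 x)).smul hG) (fun x => ?_)
    fun x hx => ?_
  · simp [norm_smul, hG0 x]
  · have : G x = x := by rw [hGS (by simpa using hx), hFout x (by linarith), hx, inv_one, one_smul]
    rw [this, hx, inv_one, one_smul]

end NotContractible
end

noncomputable section

/-! ### Coverings -/

section Coverings

open scoped Topology

variable {X Y Z : Type*} [TopologicalSpace X] [TopologicalSpace Y] [TopologicalSpace Z]

theorem IsEvenlyCovered.prodMap_id {p : Y → Z} {z : Z} {F : Type*} [TopologicalSpace F]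
    (h : IsEvenlyCovered p z F) (x : X) :
    IsEvenlyCovered (Prod.map (id : X → X) p) (x, z) F := by
  obtain ⟨hF, U, hzU, hU, hpU, e, he⟩ := h
  have hes : ∀ (w : U) (i : F), p (e.symm (w, i)) = w := fun w i => by
    rw [← he, e.apply_symm_apply]
  refine ⟨hF, Set.univ ×ˢ U, ⟨trivial, hzU⟩, isOpen_univ.prod hU, ?_, ?_⟩
  · convert isOpen_univ.prod hpU
    ext w
    simp
  · exact ⟨
      { toFun := fun w => (⟨(w.1.1, (e ⟨w.1.2, w.2.2⟩).1), trivial, (e ⟨w.1.2, w.2.2⟩).1.2⟩,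
          (e ⟨w.1.2, w.2.2⟩).2)
        invFun := fun w => ⟨(w.1.1.1, e.symm (⟨w.1.1.2, w.1.2.2⟩, w.2)), trivial, by
          rw [Prod.map_snd, hes]; exact w.1.2.2⟩
        left_inv := fun w => by simp
        right_inv := fun w => by simp
        continuous_toFun := by fun_prop
        continuous_invFun := by fun_prop },
      fun w => Prod.ext rfl (he _)⟩

theorem IsCoveringMap.prodMap_id {p : Y → Z} (hp : IsCoveringMap p) :
    IsCoveringMap (Prod.map (id : X → X) p) := fun w =>
  ((hp w.2).prodMap_id w.1).to_isEvenlyCovered_preimage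

variable {E₁ : Type*} [NormedAddCommGroup E₁] [NormedSpace ℝ E₁]
  {H₁ : Type*} [TopologicalSpace H₁] {I₁ : ModelWithCorners ℝ E₁ H₁} [ChartedSpace H₁ X]
  {E₂ : Type*} [NormedAddCommGroup E₂] [NormedSpace ℝ E₂]
  {H₂ : Type*} [TopologicalSpace H₂] {I₂ : ModelWithCorners ℝ E₂ H₂} [ChartedSpace H₂ Y]
  {E₃ : Type*} [NormedAddCommGroup E₃] [NormedSpace ℝ E₃]
  {H₃ : Type*} [TopologicalSpace H₃] {I₃ : ModelWithCorners ℝ E₃ H₃} [ChartedSpace H₃ Z]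

theorem IsLocalDiffeomorph.prodMap_id {p : Y → Z} (hp : IsLocalDiffeomorph I₂ I₃ ∞ p) :
    IsLocalDiffeomorph (I₁.prod I₂) (I₁.prod I₃) ∞ (Prod.map (id : X → X) p) := by
  intro w
  obtain ⟨Φ, hw, hΦ⟩ := hp w.2
  refine ⟨{ toPartialEquiv := (PartialEquiv.refl X).prod Φ.toPartialEquiv
            open_source := isOpen_univ.prod Φ.open_source
            open_target := isOpen_univ.prod Φ.open_target
            contMDiffOn_toFun := contMDiffOn_id.prodMap Φ.contMDiffOn_toFun
            contMDiffOn_invFun := contMDiffOn_id.prodMap Φ.contMDiffOn_invFun },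
    ⟨trivial, hw⟩, fun z hz => Prod.ext rfl (hΦ hz.2)⟩

theorem IsSmoothCovering.prodMap_id {p : Y → Z} (hp : IsSmoothCovering I₂ I₃ p) :
    IsSmoothCovering (I₁.prod I₂) (I₁.prod I₃) (Prod.map (id : X → X) p) :=
  ⟨hp.1.prodMap_id, Function.surjective_id.prodMap hp.2.1, hp.2.2.prodMap_id⟩

theorem IsRiemannianCovering.prodMap_id (g₁ : TwoTensor I₁ X) {g₂ : TwoTensor I₂ Y}
    {g₃ : TwoTensor I₃ Z} {p : Y → Z} (hp : IsRiemannianCovering g₂ g₃ p) :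
    IsRiemannianCovering (g₁.prod g₂) (g₁.prod g₃) (Prod.map id p) := by
  refine ⟨hp.1.prodMap_id, funext fun w => LinearMap.ext₂ fun u v => ?_⟩
  have hd : MDifferentiableAt I₂ I₃ p w.2 := hp.1.2.2.mdifferentiable (by simp) w.2
  rw [TwoTensor.pullback_apply, mfderiv_prodMap mdifferentiableAt_id hd, TwoTensor.prod_apply,
    TwoTensor.prod_apply, ← hp.2, mfderiv_id]
  rfl

/-- A continuous lift of a smooth map through a local diffeomorphism is smooth. -/
theorem ContMDiff.of_comp_isLocalDiffeomorph {p : Y → Z} (hp : IsLocalDiffeomorph I₂ I₃ ∞ p)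
    {f : X → Y} (hf : Continuous f) (hpf : ContMDiff I₁ I₃ ∞ (p ∘ f)) : ContMDiff I₁ I₂ ∞ f := by
  intro x
  have hx := hp (f x)
  have h1 : f =ᶠ[𝓝 x] hx.localInverse ∘ (p ∘ f) := by
    filter_upwards [hf.continuousAt.eventually hx.localInverse_eventuallyEq_left] with y hy
    exact hy.symm
  exact (hx.localInverse_contMDiffAt.comp x hpf.contMDiffAt).congr_of_eventuallyEq h1

/-- Universal coverings are unique up to diffeomorphism. -/
theorem IsUniversalCovering.nonempty_diffeomorph [LocallyPathConnectedSpace X]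
    [LocallyPathConnectedSpace Y] {p : X → Z} {q : Y → Z} (hp : IsUniversalCovering I₁ I₃ p)
    (hq : IsUniversalCovering I₂ I₃ q) : Nonempty (X ≃ₘ^∞⟮I₁, I₂⟯ Y) := by
  obtain ⟨_, hpc, -, hpd⟩ := hp
  obtain ⟨_, hqc, hqs, hqd⟩ := hq
  obtain ⟨x₀⟩ : Nonempty X := inferInstance
  obtain ⟨y₀, hy₀⟩ := hqs (p x₀)
  obtain ⟨f, ⟨hf₀, hf⟩, -⟩ := hqc.existsUnique_continuousMap_lifts ⟨p, hpc.continuous⟩ x₀ y₀ hy₀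
  obtain ⟨h, ⟨hh₀, hh⟩, -⟩ :=
    hpc.existsUnique_continuousMap_lifts ⟨q, hqc.continuous⟩ y₀ x₀ hy₀.symm
  have hf' : q ∘ f = p := hf
  have hh' : p ∘ h = q := hh
  have h1 : ⇑h ∘ ⇑f = id := hpc.eq_of_comp_eq (h.continuous.comp f.continuous) continuous_id
    (by rw [← Function.comp_assoc, hh', hf', Function.comp_id]) x₀ (by simp [hf₀, hh₀])
  have h2 : ⇑f ∘ ⇑h = id := hqc.eq_of_comp_eq (f.continuous.comp h.continuous) continuous_id
    (by rw [← Function.comp_assoc, hf', hh', Function.comp_id]) y₀ (by simp [hf₀, hh₀])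
  have hfs : ContMDiff I₁ I₂ ∞ f :=
    ContMDiff.of_comp_isLocalDiffeomorph hqd f.continuous (hf'.symm ▸ hpd.contMDiff)
  have hhs : ContMDiff I₂ I₁ ∞ h :=
    ContMDiff.of_comp_isLocalDiffeomorph hpd h.continuous (hh'.symm ▸ hqd.contMDiff)
  exact ⟨⟨⟨f, h, congrFun h1, congrFun h2⟩, hfs, hhs⟩⟩

/-- The product of a simply connected space with a contractible space is simply connected. -/
theorem simplyConnectedSpace_prod [SimplyConnectedSpace X] [ContractibleSpace Y] :
    SimplyConnectedSpace (X × Y) := by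
  obtain ⟨e⟩ := ContractibleSpace.hequiv_unit Y
  exact (((ContinuousMap.HomotopyEquiv.refl X).prodCongr e).trans
    (Homeomorph.prodPUnit X).toHomotopyEquiv).simplyConnectedSpace

theorem ContractibleSpace.of_prod_left [ContractibleSpace (X × Y)] [ContractibleSpace Y] :
    ContractibleSpace X := by
  obtain ⟨e⟩ := ContractibleSpace.hequiv_unit Y
  exact (((ContinuousMap.HomotopyEquiv.refl X).prodCongr e).trans
    (Homeomorph.prodPUnit X).toHomotopyEquiv).symm.contractibleSpace

end Coverings

/-! ### The half-space and the product with the sphere -/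

section HalfSpace

theorem contractibleSpace_upperHalfSpace (k : ℕ) : ContractibleSpace (upperHalfSpace k) := by
  have hc : Convex ℝ {y : EuclideanSpace ℝ (Fin (k + 1)) | 0 < y 0} :=
    (convex_Ioi (0 : ℝ)).linear_preimage (EuclideanSpace.proj (𝕜 := ℝ) (0 : Fin (k + 1))).toLinearMap
  exact hc.contractibleSpace ⟨EuclideanSpace.single 0 1, by simp⟩

/-- The coordinates `(log y₀, y₁, …, y_k)` on the half-space. -/
def upperHalfSpaceDiffeomorph (k : ℕ) :
    upperHalfSpace k ≃ₘ^∞⟮𝓡 (k + 1), 𝓡 (k + 1)⟯ EuclideanSpace ℝ (Fin (k + 1)) where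
  toFun y := WithLp.toLp 2 (Fin.cons (Real.log (y.1 0)) fun i => y.1 i.succ)
  invFun z := ⟨WithLp.toLp 2 (Fin.cons (Real.exp (z 0)) fun i => z i.succ), Real.exp_pos _⟩
  left_inv y := by
    have hy : 0 < y.1 0 := y.2
    refine Subtype.ext (PiLp.ext fun i => ?_)
    refine Fin.cases ?_ (fun j => ?_) i
    · simp [Real.exp_log hy]
    · simp
  right_inv z := by
    refine PiLp.ext fun i => ?_
    refine Fin.cases ?_ (fun j => ?_) i
    · simp
    · simp
  contMDiff_toFun := by
    intro y
    have hy : y.1 0 ≠ 0 := (show 0 < y.1 0 from y.2).ne'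
    refine contMDiffAt_subtype_iff (f := fun y : EuclideanSpace ℝ (Fin (k + 1)) =>
      (WithLp.toLp 2 (Fin.cons (Real.log (y 0)) fun i => y i.succ) :
        EuclideanSpace ℝ (Fin (k + 1)))) |>.2 ?_
    rw [contMDiffAt_iff_contDiffAt, contDiffAt_euclidean]
    refine Fin.cases ?_ fun j => ?_
    · exact ContDiffAt.log (by fun_prop) hy
    · simp only [Fin.cons_succ]
      fun_prop
  contMDiff_invFun := by
    have h : ContDiff ℝ ∞ fun z : EuclideanSpace ℝ (Fin (k + 1)) =>
        (WithLp.toLp 2 (Fin.cons (Real.exp (z 0)) fun i => z i.succ) :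
          EuclideanSpace ℝ (Fin (k + 1))) := by
      rw [contDiff_euclidean]
      refine Fin.cases ?_ fun j => ?_
      · simp only [Fin.cons_zero]
        fun_prop
      · simp only [Fin.cons_succ]
        fun_prop
    exact (ContMDiff.subtypeVal_comp_iff _ _).1 h.contMDiff

theorem isUniversalCovering_prodMap_id {m k : ℕ} (hm : 2 ≤ m) {S : Type*} [TopologicalSpace S]
    [ChartedSpace (EuclideanSpace ℝ (Fin (k + 1))) S] {p : upperHalfSpace k → S}
    (hp : IsSmoothCovering (𝓡 (k + 1)) (𝓡 (k + 1)) p) :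
    IsUniversalCovering ((𝓡 m).prod (𝓡 (k + 1))) ((𝓡 m).prod (𝓡 (k + 1)))
      (Prod.map id p : UnitSphere m × upperHalfSpace k → UnitSphere m × S) := by
  have h1 : SimplyConnectedSpace (UnitSphere m) := simplyConnectedSpace_sphere (by simp; omega)
  have h2 := contractibleSpace_upperHalfSpace k
  exact ⟨simplyConnectedSpace_prod, hp.prodMap_id⟩

end HalfSpace
end

theorem mainTheorem5 (k n : ℕ) (hn : 2 * k + 3 ≤ n)
    (S : Type*) [TopologicalSpace S] [T2Space S] [SecondCountableTopology S]
    [ChartedSpace (EuclideanSpace ℝ (Fin (k + 1))) S] [IsManifold (𝓡 (k + 1)) ∞ S]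
    [MeasurableSpace S] [BorelSpace S]
    (gS : Bundle.ContMDiffRiemannianMetric (𝓡 (k + 1)) ∞ (EuclideanSpace ℝ (Fin (k + 1)))
      (TangentSpace (𝓡 (k + 1)) : S → Type _))
    (hS : IsCompactHyperbolic (riemannianTensor gS)) :
    -- the product metric has constant positive scalar curvature
    (∀ x : UnitSphere (n - k - 1) × S,
      scalarCurvature ((roundMetric (n - k - 1)).prod (riemannianTensor gS)) x
        = ((n : ℝ) - 2 * k - 2) * ((n : ℝ) - 1)) ∧
    0 < ((n : ℝ) - 2 * k - 2) * ((n : ℝ) - 1) ∧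
    -- its conformal class has positive Yamabe constant
    0 < yamabeConstant ((roundMetric (n - k - 1)).prod (riemannianTensor gS)) ∧
    -- the product of the sphere with the hyperbolic covering is a universal Riemannian covering
    (∀ p : upperHalfSpace k → S,
      IsRiemannianCovering (hyperbolicMetric k) (riemannianTensor gS) p →
        IsUniversalCovering ((𝓡 (n - k - 1)).prod (𝓡 (k + 1))) ((𝓡 (n - k - 1)).prod (𝓡 (k + 1)))
          (Prod.map id p : UnitSphere (n - k - 1) × upperHalfSpace k →
            UnitSphere (n - k - 1) × S) ∧
        IsRiemannianCovering ((roundMetric (n - k - 1)).prod (hyperbolicMetric k))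
          ((roundMetric (n - k - 1)).prod (riemannianTensor gS)) (Prod.map id p)) ∧
    -- every universal covering is diffeomorphic to `S^{n-k-1} × ℝ^{k+1}`, is not contractible, and
    -- with the pulled back metric is not conformally equivalent to Euclidean space
    (∀ (M : Type*) [TopologicalSpace M]
      [ChartedSpace (ModelProd (EuclideanSpace ℝ (Fin (n - k - 1)))
        (EuclideanSpace ℝ (Fin (k + 1)))) M]
      [IsManifold ((𝓡 (n - k - 1)).prod (𝓡 (k + 1))) ∞ M]
      (π : M → UnitSphere (n - k - 1) × S),
      IsUniversalCovering ((𝓡 (n - k - 1)).prod (𝓡 (k + 1)))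
          ((𝓡 (n - k - 1)).prod (𝓡 (k + 1))) π →
        Nonempty (M ≃ₘ^∞⟮(𝓡 (n - k - 1)).prod (𝓡 (k + 1)),
          (𝓡 (n - k - 1)).prod (𝓡 (k + 1))⟯
            (UnitSphere (n - k - 1) × EuclideanSpace ℝ (Fin (k + 1)))) ∧
        ¬ ContractibleSpace M ∧
        ¬ ConformallyEquivalent
          (TwoTensor.pullback ((𝓡 (n - k - 1)).prod (𝓡 (k + 1)))
            ((roundMetric (n - k - 1)).prod (riemannianTensor gS)) π)
          (flatMetric n)) := by
  obtain ⟨hcomp, p₀, hp₀⟩ := hS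
  obtain ⟨m, rfl⟩ : ∃ m, n = m + k + 1 := ⟨n - k - 1, by omega⟩
  have hm : m + k + 1 - k - 1 = m := by omega
  rw [hm]
  have hk : k + 2 ≤ m := by omega
  have hpos : ∀ s (v : TangentSpace (𝓡 (k + 1)) s), v ≠ 0 → 0 < riemannianTensor gS s v v :=
    gS.pos
  have hsymm : ∀ s (v w : TangentSpace (𝓡 (k + 1)) s),
      riemannianTensor gS s v w = riemannianTensor gS s w v := gS.symm
  have hscal : ∀ x : UnitSphere m × S,
      scalarCurvature ((roundMetric m).prod (riemannianTensor gS)) x =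
        (((m + k + 1 : ℕ) : ℝ) - 2 * k - 2) * (((m + k + 1 : ℕ) : ℝ) - 1) := by
    intro x
    rw [scalarCurvature_roundMetric_prod hp₀ hpos x]
    push_cast
    ring
  have hR : 0 < (((m + k + 1 : ℕ) : ℝ) - 2 * k - 2) * (((m + k + 1 : ℕ) : ℝ) - 1) := by
    have h1 : ((k + 2 : ℕ) : ℝ) ≤ m := Nat.cast_le.2 hk
    push_cast at h1 ⊢
    have h2 : (0 : ℝ) ≤ k := Nat.cast_nonneg k
    exact mul_pos (by linarith) (by linarith)
  have hsph : SimplyConnectedSpace (UnitSphere m) := simplyConnectedSpace_sphere (by simp; omega)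
  have hne : Nonempty (UnitSphere m × S) :=
    ⟨(Classical.arbitrary _, p₀ ⟨EuclideanSpace.single 0 1, by simp [upperHalfSpace]⟩)⟩
  have hg : IsContinuousMetric ((roundMetric m).prod (riemannianTensor gS)) :=
    ⟨roundMetric_prod_symm hsymm, roundMetric_prod_pos hpos,
      continuousOn_chartCoefficients_roundMetric_prod hp₀ hpos⟩
  refine ⟨hscal, hR, hg.yamabeConstant_pos (by simp; omega) hR hscal, fun p hp =>
    ⟨isUniversalCovering_prodMap_id (by omega) hp.1, hp.prodMap_id _⟩, ?_⟩
  intro M _ _ _ π hπ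
  have hlp : LocallyPathConnectedSpace
      (ModelProd (EuclideanSpace ℝ (Fin m)) (EuclideanSpace ℝ (Fin (k + 1)))) :=
    inferInstanceAs (LocallyPathConnectedSpace
      (EuclideanSpace ℝ (Fin m) × EuclideanSpace ℝ (Fin (k + 1))))
  have hlpM : LocallyPathConnectedSpace M := ChartedSpace.locallyPathConnectedSpace
    (ModelProd (EuclideanSpace ℝ (Fin m)) (EuclideanSpace ℝ (Fin (k + 1)))) M
  have hlpX : LocallyPathConnectedSpace (UnitSphere m × upperHalfSpace k) :=
    ChartedSpace.locallyPathConnectedSpace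
      (ModelProd (EuclideanSpace ℝ (Fin m)) (EuclideanSpace ℝ (Fin (k + 1)))) _
  obtain ⟨Φ⟩ := hπ.nonempty_diffeomorph (isUniversalCovering_prodMap_id (by omega) hp₀.1)
  let Ψ := Φ.trans ((Diffeomorph.refl (𝓡 m) (UnitSphere m) ∞).prodCongr
    (upperHalfSpaceDiffeomorph k))
  have hnc : ¬ ContractibleSpace M := by
    intro hM
    have h1 : ContractibleSpace (UnitSphere m × EuclideanSpace ℝ (Fin (k + 1))) :=
      Ψ.toHomeomorph.symm.contractibleSpace
    exact not_contractibleSpace_sphere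
      (ContractibleSpace.of_prod_left (X := UnitSphere m) (Y := EuclideanSpace ℝ (Fin (k + 1))))
  exact ⟨⟨Ψ⟩, hnc, fun ⟨F, _⟩ => hnc F.toHomeomorph.contractibleSpace⟩
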